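/- Let $X$ be a square-integrable random variable with law $\nu$ on a probability space with measure $\mathbb{P}$. For $i=1,\dots,n$ let $\xi^{(i)}_t=tX+\sigma_i\beta^{(i)}_t$, $t\in[0,1]$, where $\sigma_i>0$ and $X,\beta^{(1)},\dots,\beta^{(n)}$ are mutually independent, each $\beta^{(i)}$ being a standard Brownian bridge (a centred Gaussian process with covariance $\min(s,t)-st$). Let $(\tilde J_t)_{t\in[0,1]}$ be a c\`adl\`ag process with values in $\mathbb{S}=\{0,1\}^n$, independent of $(\xi^{(1)},\dots,\xi^{(n)})$; source $i$ is active at time $t$ if $\tilde J^{(i)}_t=1$. Let $(\mathcal{F}_t)$ be the right-continuous, complete version of the filtration $$\sigma\big((\tilde J^{(i)}_u\xi^{(i)}_u)_{0\le u\le t,\,1\le i\le n},\ (\tilde J_u)_{0\le u\le t},\ X\mathbf 1_{\{t=1\}}\big).$$ Assume that almost surely sources never switch off ($\tilde J^{(i)}_t=1$ implies $\tilde J^{(i)}_u=1$ for all $u\ge t$) and at least one source is active at time $0$. Let $s\mapsto P_{0s}\in(0,1]$, $s\ge 0$, be a differentiable, strictly decreasing discount function with $P_{0s}\to0$ as $s\to\infty$,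 and set $P_{t1}=P_{01}/P_{0t}$ for $0\le t\le 1$. The asset price is $\overline X_t=P_{t1}\mathbb{E}[X\mid\mathcal{F}_t]$. Fix $t\in(0,1)$ and a strike $K\in\mathbb{R}$ with $\mathbb{P}(P_{t1}X<K)>0$ and $\mathbb{P}(P_{t1}X>K)>0$, and let $C_0=P_{0t}\,\mathbb{E}[(\overline X_t-K)^+]$ be the time-$0$ price of the European call with strike $K$ exercisable at $t$. For $k\in\mathbb{S}$, $k\ne0$, put $\hat\sigma(k)=\big(\sum_{i:k_i=1}\sigma_i^{-2}\big)^{-1/2}$. Then $(\overline X_t-K)^+$ is integrable. For every $k\in\mathbb{S}$ with $k\neq0$ the integrand below is $\nu$-integrable for each real $\varsigma$, and there is a unique real number $\varsigma=\hat\varsigma(k)$ solving $$\int_{\mathbb{R}}(P_{t1}x-K)\exp\!\left[\frac{x\,\varsigma-tx^2/2}{\hat\sigma^2(k)(1-t)}\right]\nu(\mathrm{d}x)=0 .$$ With $\hat z_t(k)=\hat\varsigma(k)\big/\big(\hat\sigma(k)\sqrt{t(1-t)}\big)$ and $\mathcal N$ the standard normal distribution function, one has $$\begin{aligned}C_0={}&P_{0t}\sum_{k\in\mathbb{S}}\mathbb{P}(\tilde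 J_t=k)\,P_{t1}\int_{\mathbb{R}}x\,\mathcal N\!\left(-\hat z_t(k)+\frac{x\sqrt t}{\hat\sigma(k)\sqrt{1-t}}\right)\nu(\mathrm{d}x)\\&-P_{0t}\sum_{k\in\mathbb{S}}\mathbb{P}(\tilde J_t=k)\,K\int_{\mathbb{R}}\mathcal N\!\left(-\hat z_t(k)+\frac{x\sqrt t}{\hat\sigma(k)\sqrt{1-t}}\right)\nu(\mathrm{d}x),\end{aligned}$$ where all integrals converge, and the state $k=0$ contributes nothing because $\mathbb{P}(\tilde J_t=0)=0$. -/

import Mathlib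

open MeasureTheory ProbabilityTheory Filter Topology Set

noncomputable section

namespace ModulatedInfo

/-- A standard Brownian bridge on `[0,1]`: a centred Gaussian process with covariance function
`(s, t) ↦ min s t - s t`. -/
structure IsBrownianBridge {Ω : Type*} [MeasurableSpace Ω] (B : unitInterval → Ω → ℝ)
    (μ : Measure Ω) : Prop where
  measurable : ∀ t, Measurable (B t)
  gaussian : IsGaussianProcess B μ
  mean : ∀ t, ∫ ω, B t ω ∂μ = 0
  covariance : ∀ s t : unitInterval,
    cov[B s, B t; μ] = min (s : ℝ) (t : ℝ) - (s : ℝ) * (t : ℝ)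

/-- The coordinate information processes `ξ⁽ⁱ⁾_t = t X + σ_i β⁽ⁱ⁾_t`. -/
def infoProcess {Ω : Type*} {n : ℕ} (X : Ω → ℝ) (σ : Fin n → ℝ)
    (β : Fin n → unitInterval → Ω → ℝ) (i : Fin n) (t : unitInterval) (ω : Ω) : ℝ :=
  (t : ℝ) * X ω + σ i * β i t ω

/-- The path `f` on `[0,1]` is right-continuous with left limits. For a path in the finite
discrete space `{0,1}ⁿ` this says that it is right-continuous and switches state at only finitely
many times. -/
def IsCadlag {E : Type*} [TopologicalSpace E] (f : unitInterval → E) : Prop :=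
  ∀ t, ContinuousWithinAt f (Ici t) t ∧ ∃ l, Tendsto f (𝓝[<] t) (𝓝 l)

/-- The modulated information process `J_t ξ_t`: a coordinate is shown while its source is active
and vanishes otherwise. -/
def modulated {Ω : Type*} {n : ℕ} (ξ : Fin n → unitInterval → Ω → ℝ)
    (J : unitInterval → Ω → Fin n → Bool) (t : unitInterval) (ω : Ω) (i : Fin n) : ℝ :=
  if J t ω i = true then ξ i t ω else 0

/-- The σ-algebra generated by `(J_u ξ_u)` and `(J_u)` for `0 ≤ u ≤ t`, and by `X 1_{t = 1}`. -/
@[reducible]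
def observedSigma {Ω : Type*} {n : ℕ} (X : Ω → ℝ) (ξ : Fin n → unitInterval → Ω → ℝ)
    (J : unitInterval → Ω → Fin n → Bool) (t : unitInterval) : MeasurableSpace Ω :=
  (⨆ u : Iic t, MeasurableSpace.comap (modulated ξ J u) inferInstance) ⊔
    (⨆ u : Iic t, MeasurableSpace.comap (J u) inferInstance) ⊔
    MeasurableSpace.comap (fun ω => if t = 1 then X ω else 0) inferInstance

theorem observedSigma_mono {Ω : Type*} {n : ℕ} (X : Ω → ℝ) (ξ : Fin n → unitInterval → Ω → ℝ)
    (J : unitInterval → Ω → Fin n → Bool) : Monotone (observedSigma X ξ J) := by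
  intro s t hst
  refine sup_le_sup (sup_le_sup ?_ ?_) ?_
  · exact iSup_le fun u => le_iSup_of_le (⟨u.1, le_trans u.2 hst⟩ : Iic t) le_rfl
  · exact iSup_le fun u => le_iSup_of_le (⟨u.1, le_trans u.2 hst⟩ : Iic t) le_rfl
  · by_cases hs : s = 1
    · have ht : t = 1 := le_antisymm unitInterval.le_one' (hs ▸ hst)
      simp only [hs, ht, le_refl]
    · simp only [hs, if_false, MeasurableSpace.comap_const, bot_le]

/-- The completion of the filtration of observations: all events that agree with an observed
event up to a null set. -/
def completedFiltration {Ω : Type*} {n : ℕ} [m0 : MeasurableSpace Ω] (μ : Measure Ω)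
    (X : Ω → ℝ) (ξ : Fin n → unitInterval → Ω → ℝ) (J : unitInterval → Ω → Fin n → Bool) :
    Filtration unitInterval m0 where
  seq t := m0 ⊓ eventuallyMeasurableSpace (observedSigma X ξ J t) (ae μ)
  mono' _ _ hst := inf_le_inf_left _
    fun _ ⟨B, hB, hAB⟩ => ⟨B, observedSigma_mono X ξ J hst B hB, hAB⟩
  le' _ := inf_le_left

/-- The market filtration `(𝓕_t)`: the right-continuous and complete version of the filtration
of observations. -/
def marketFiltration {Ω : Type*} {n : ℕ} [m0 : MeasurableSpace Ω] (μ : Measure Ω)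
    (X : Ω → ℝ) (ξ : Fin n → unitInterval → Ω → ℝ) (J : unitInterval → Ω → Fin n → Bool) :
    Filtration unitInterval m0 :=
  (completedFiltration μ X ξ J).rightCont

/-- A deterministic system of discount functions `t ↦ P_{0t}`, `t ≥ 0`. -/
structure IsDiscountFunction (P : ℝ → ℝ) : Prop where
  differentiableOn : DifferentiableOn ℝ P (Ici 0)
  strictAntiOn : StrictAntiOn P (Ici 0)
  pos : ∀ t, 0 ≤ t → 0 < P t
  le_one : ∀ t, 0 ≤ t → P t ≤ 1
  tendsto_zero : Tendsto P atTop (𝓝 0)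

/-- The discount factor `P_{t1} = P_{01} / P_{0t}` from time `1` back to time `t`. -/
def discountToOne (P : ℝ → ℝ) (t : ℝ) : ℝ := P 1 / P t

/-- The asset price `P_{t1} E[X | 𝓕_t]`. -/
def assetPrice {Ω : Type*} [m0 : MeasurableSpace Ω] (μ : Measure Ω)
    (𝓕 : Filtration unitInterval m0) (P : ℝ → ℝ) (X : Ω → ℝ) (t : unitInterval) (ω : Ω) : ℝ :=
  discountToOne P t * (μ[X | 𝓕 t]) ω

/-- The time-`0` price `P_{0t} E[(S - K)⁺]` of the claim that pays `(S - K)⁺` at time `t`. -/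
def callPrice {Ω : Type*} [MeasurableSpace Ω] (μ : Measure Ω) (P : ℝ → ℝ) (S : Ω → ℝ) (K : ℝ)
    (t : unitInterval) : ℝ :=
  P t * ∫ ω, max (S ω - K) 0 ∂μ

/-- The effective volatility `σ̂(k) = (∑_{i active} σ_i⁻²)^{-1/2}` in the activity state
`k ∈ {0,1}ⁿ`, which is `0` if no source is active. -/
def effVol {n : ℕ} (σ : Fin n → ℝ) (k : Fin n → Bool) : ℝ :=
  (√(∑ i with k i = true, (σ i ^ 2)⁻¹))⁻¹

/-- The integrand in `x` of the equation for the critical level `z`: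
`(p x - K) exp ((x z - t x² / 2) / (s² (1 - t)))`. -/
def criticalIntegrand (p K s t z x : ℝ) : ℝ :=
  (p * x - K) * Real.exp ((x * z - t * x ^ 2 / 2) / (s ^ 2 * (1 - t)))

/-- The standard normal distribution function. -/
def stdNormalCDF (x : ℝ) : ℝ := cdf (gaussianReal 0 1) x

/-- `𝓝(-ẑ + x √t / (s √(1 - t)))` with `ẑ = z / (s √(t (1 - t)))`. -/
def exerciseProb (s t z x : ℝ) : ℝ :=
  stdNormalCDF (-(z / (s * √(t * (1 - t)))) + x * √t / (s * √(1 - t)))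

end ModulatedInfo

end

open ModulatedInfo

namespace ModulatedInfo

/-- The likelihood of the signal value `x` given the level `y` of an information process with
volatility `c` at time `s`, up to a factor that depends on `y` only. -/
noncomputable def likelihood (c s y x : ℝ) : ℝ :=
  Real.exp ((x * y - s * x ^ 2 / 2) / (c ^ 2 * (1 - s)))

/-- The conditional mean of a signal with prior `ν` given the level `y` of an information process
with volatility `c` at time `s`. -/
noncomputable def posteriorMean (ν : Measure ℝ) (c s y : ℝ) : ℝ :=
  (∫ x, x * likelihood c s y x ∂ν) / ∫ x, likelihood c s y x ∂ν

lemma likelihood_pos (c s y x : ℝ) : 0 < likelihood c s y x := Real.exp_pos _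

@[fun_prop]
lemma measurable_likelihood (c s y : ℝ) : Measurable (likelihood c s y) := by
  unfold likelihood; fun_prop

lemma measurable_likelihood_uncurry (c s : ℝ) :
    Measurable (fun q : ℝ × ℝ => likelihood c s q.2 q.1) := by
  unfold likelihood; fun_prop

lemma likelihood_le {c s : ℝ} (hc : 0 < c) (hs0 : 0 < s) (hs1 : s < 1) (y x : ℝ) :
    likelihood c s y x ≤ Real.exp (y ^ 2 / (2 * s) / (c ^ 2 * (1 - s))) := by
  unfold likelihood
  have h1 : 0 < 1 - s := by linarith
  gcongr
  rw [le_div_iff₀ (by positivity)]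
  nlinarith [sq_nonneg (y - s * x)]

lemma integrable_mul_likelihood {ν : Measure ℝ} {f : ℝ → ℝ} (hf : Integrable f ν) {c s : ℝ}
    (hc : 0 < c) (hs0 : 0 < s) (hs1 : s < 1) (y : ℝ) :
    Integrable (fun x => f x * likelihood c s y x) ν := by
  refine hf.mul_bdd (c := Real.exp (y ^ 2 / (2 * s) / (c ^ 2 * (1 - s))))
    (measurable_likelihood c s y).aestronglyMeasurable (.of_forall fun x => ?_)
  rw [Real.norm_of_nonneg (likelihood_pos ..).le]
  exact likelihood_le hc hs0 hs1 y x

lemma integrable_likelihood {ν : Measure ℝ} [IsFiniteMeasure ν] {c s : ℝ}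
    (hc : 0 < c) (hs0 : 0 < s) (hs1 : s < 1) (y : ℝ) :
    Integrable (likelihood c s y) ν := by
  simpa using integrable_mul_likelihood (integrable_const (1 : ℝ)) hc hs0 hs1 y

lemma integral_likelihood_pos {ν : Measure ℝ} [IsProbabilityMeasure ν] {c s : ℝ}
    (hc : 0 < c) (hs0 : 0 < s) (hs1 : s < 1) (y : ℝ) :
    0 < ∫ x, likelihood c s y x ∂ν := by
  rw [integral_pos_iff_support_of_nonneg (fun x => (likelihood_pos c s y x).le)
    (integrable_likelihood hc hs0 hs1 y)]
  have : Function.support (likelihood c s y) = univ :=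
    eq_univ_of_forall fun x => (likelihood_pos c s y x).ne'
  simp [this]

lemma tendsto_integral_mul_likelihood {ν : Measure ℝ} {f : ℝ → ℝ} (hf : Integrable f ν) {c s y : ℝ}
    (hc : 0 < c) (hs0 : 0 < s) (hs1 : s < 1) {ι : Type*} {l : Filter ι} [l.IsCountablyGenerated]
    {u v : ι → ℝ} (hu : Tendsto u l (𝓝 s)) (hv : Tendsto v l (𝓝 y)) :
    Tendsto (fun i => ∫ x, f x * likelihood c (u i) (v i) x ∂ν) l
      (𝓝 (∫ x, f x * likelihood c s y x ∂ν)) := by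
  have h1 : 0 < 1 - s := by linarith
  have hden : Tendsto (fun i => c ^ 2 * (1 - u i)) l (𝓝 (c ^ 2 * (1 - s))) :=
    (tendsto_const_nhds.sub hu).const_mul _
  have hb : Tendsto (fun i => Real.exp ((v i) ^ 2 / (2 * u i) / (c ^ 2 * (1 - u i)))) l
      (𝓝 (Real.exp (y ^ 2 / (2 * s) / (c ^ 2 * (1 - s))))) :=
    (Real.continuous_exp.tendsto _).comp
      (((hv.pow 2).div (hu.const_mul 2) (by positivity)).div hden (by positivity))
  set L := Real.exp (y ^ 2 / (2 * s) / (c ^ 2 * (1 - s)))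
  have hev : ∀ᶠ i in l, 0 < u i ∧ u i < 1 ∧
      Real.exp ((v i) ^ 2 / (2 * u i) / (c ^ 2 * (1 - u i))) < L + 1 :=
    (hu.eventually_const_lt hs0).and
      ((hu.eventually_lt_const hs1).and (hb.eventually_lt_const (lt_add_one L)))
  refine tendsto_integral_filter_of_dominated_convergence (fun x => |f x| * (L + 1))
    (.of_forall fun i => hf.aestronglyMeasurable.mul
      (measurable_likelihood c (u i) (v i)).aestronglyMeasurable) ?_ (hf.abs.mul_const _) ?_
  · filter_upwards [hev] with i ⟨hi0, hi1, hi⟩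
    refine .of_forall fun x => ?_
    rw [norm_mul, Real.norm_eq_abs, Real.norm_of_nonneg (likelihood_pos ..).le]
    gcongr
    exact (likelihood_le hc hi0 hi1 _ x).trans hi.le
  · refine .of_forall fun x => Tendsto.const_mul _ ?_
    unfold likelihood
    exact (Real.continuous_exp.tendsto _).comp
      (((hv.const_mul x).sub ((hu.mul_const _).div_const _)).div hden (by positivity))

lemma tendsto_posteriorMean {ν : Measure ℝ} [IsProbabilityMeasure ν]
    (hν : Integrable (fun x => x) ν) {c s y : ℝ}
    (hc : 0 < c) (hs0 : 0 < s) (hs1 : s < 1) {ι : Type*} {l : Filter ι} [l.IsCountablyGenerated]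
    {u v : ι → ℝ} (hu : Tendsto u l (𝓝 s)) (hv : Tendsto v l (𝓝 y)) :
    Tendsto (fun i => posteriorMean ν c (u i) (v i)) l (𝓝 (posteriorMean ν c s y)) := by
  refine (tendsto_integral_mul_likelihood hν hc hs0 hs1 hu hv).div ?_
    (integral_likelihood_pos hc hs0 hs1 y).ne'
  simpa using tendsto_integral_mul_likelihood (integrable_const (1 : ℝ)) hc hs0 hs1 hu hv

@[fun_prop]
lemma measurable_posteriorMean (ν : Measure ℝ) [SFinite ν] (c s : ℝ) :
    Measurable (posteriorMean ν c s) := by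
  have h := measurable_likelihood_uncurry c s
  refine Measurable.div ?_ ?_
  · exact (StronglyMeasurable.integral_prod_left'
      (f := fun q : ℝ × ℝ => q.1 * likelihood c s q.2 q.1)
      (measurable_fst.mul h).stronglyMeasurable).measurable
  · exact (StronglyMeasurable.integral_prod_left'
      (f := fun q : ℝ × ℝ => likelihood c s q.2 q.1) h.stronglyMeasurable).measurable

lemma criticalIntegrand_eq (p K c s z x : ℝ) :
    criticalIntegrand p K c s z x = (p * x - K) * likelihood c s z x := rfl

lemma integrable_criticalIntegrand {ν : Measure ℝ} [IsFiniteMeasure ν]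
    (hν : Integrable (fun x => x) ν) (p K : ℝ) {c s : ℝ}
    (hc : 0 < c) (hs0 : 0 < s) (hs1 : s < 1) (z : ℝ) :
    Integrable (criticalIntegrand p K c s z) ν :=
  integrable_mul_likelihood (f := fun x => p * x - K) ((hν.const_mul p).sub (integrable_const K))
    hc hs0 hs1 z

lemma integral_criticalIntegrand {ν : Measure ℝ} [IsProbabilityMeasure ν]
    (hν : Integrable (fun x => x) ν) (p K : ℝ) {c s : ℝ}
    (hc : 0 < c) (hs0 : 0 < s) (hs1 : s < 1) (z : ℝ) :
    ∫ x, criticalIntegrand p K c s z x ∂ν =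
      (p * posteriorMean ν c s z - K) * ∫ x, likelihood c s z x ∂ν := by
  have h0 := (integral_likelihood_pos (ν := ν) hc hs0 hs1 z).ne'
  simp_rw [criticalIntegrand_eq, sub_mul, mul_assoc]
  rw [integral_sub ((integrable_mul_likelihood hν hc hs0 hs1 z).const_mul p)
    ((integrable_likelihood hc hs0 hs1 z).const_mul K), integral_const_mul, integral_const_mul,
    posteriorMean]
  field_simp

/-- The integrand of the critical level, centred so that it increases in `θ`. -/
noncomputable def tiltedPayoff (p K r θ x : ℝ) : ℝ :=
  (p * x - K) * Real.exp ((p * x - K) * θ) * Real.exp (-(r * x ^ 2))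

lemma mul_exp_mul_strictMono {u : ℝ} (hu : u ≠ 0) :
    StrictMono fun θ : ℝ => u * Real.exp (u * θ) := by
  intro a b hab
  rcases hu.lt_or_gt with h | h
  · exact mul_lt_mul_of_neg_left (Real.exp_lt_exp.2 (mul_lt_mul_of_neg_left hab h)) h
  · exact mul_lt_mul_of_pos_left (Real.exp_lt_exp.2 (mul_lt_mul_of_pos_left hab h)) h

lemma le_mul_exp_mul (u : ℝ) {θ : ℝ} (hθ : 0 ≤ θ) :
    u + θ * max u 0 ^ 2 ≤ u * Real.exp (u * θ) := by
  rcases le_total u 0 with h | h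
  · rw [max_eq_right h]
    have : Real.exp (u * θ) ≤ 1 := Real.exp_le_one_iff.2 (mul_nonpos_of_nonpos_of_nonneg h hθ)
    nlinarith
  · rw [max_eq_left h]
    nlinarith [mul_le_mul_of_nonneg_left (Real.add_one_le_exp (u * θ)) h]

lemma criticalIntegrand_eq_tiltedPayoff {p c s : ℝ} (hp : 0 < p) (hc : 0 < c) (hs1 : s < 1)
    (K z x : ℝ) :
    criticalIntegrand p K c s z x = Real.exp (K * (z / (p * (c ^ 2 * (1 - s))))) *
      tiltedPayoff p K (s / 2 / (c ^ 2 * (1 - s))) (z / (p * (c ^ 2 * (1 - s)))) x := by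
  have h1 : 0 < 1 - s := by linarith
  rw [criticalIntegrand, tiltedPayoff, mul_comm (Real.exp _), mul_assoc, mul_assoc, ← Real.exp_add,
    ← Real.exp_add]
  congr 2
  field_simp
  ring

lemma strictMono_integral_tiltedPayoff {ν : Measure ℝ} {p K r : ℝ}
    (hint : ∀ θ, Integrable (tiltedPayoff p K r θ) ν)
    (hgt : ν {x | K < p * x} ≠ 0) : StrictMono fun θ => ∫ x, tiltedPayoff p K r θ x ∂ν := by
  intro a b hab
  have hlt : ∀ x, p * x ≠ K → tiltedPayoff p K r a x < tiltedPayoff p K r b x := fun x hx =>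
    mul_lt_mul_of_pos_right (mul_exp_mul_strictMono (sub_ne_zero.2 hx) hab) (Real.exp_pos _)
  rw [← sub_pos, ← integral_sub (hint b) (hint a), integral_pos_iff_support_of_nonneg
    (fun x => sub_nonneg.2 ?_) ((hint b).sub (hint a))]
  · exact lt_of_lt_of_le (pos_iff_ne_zero.2 hgt)
      (measure_mono fun x hx => (sub_pos.2 (hlt x (ne_of_gt hx))).ne')
  · by_cases hx : p * x = K
    · simp [tiltedPayoff, hx]
    · exact (hlt x hx).le

lemma exists_integral_tiltedPayoff_pos {ν : Measure ℝ} [IsFiniteMeasure ν]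
    (hν : MemLp (fun x => x) 2 ν) {p K r : ℝ} (hr : 0 ≤ r)
    (hint : ∀ θ, Integrable (tiltedPayoff p K r θ) ν)
    (hgt : ν {x | K < p * x} ≠ 0) : ∃ θ, 0 < ∫ x, tiltedPayoff p K r θ x ∂ν := by
  have hu : MemLp (fun x => p * x - K) 2 ν := (hν.const_mul p).sub (memLp_const K)
  have hw : ∀ x : ℝ, ‖Real.exp (-(r * x ^ 2))‖ ≤ 1 := fun x => by
    rw [Real.norm_of_nonneg (Real.exp_pos _).le]
    exact Real.exp_le_one_iff.2 (by have := mul_nonneg hr (sq_nonneg x); linarith)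
  have hwm : AEStronglyMeasurable (fun x : ℝ => Real.exp (-(r * x ^ 2))) ν :=
    (by fun_prop : Measurable fun x : ℝ => Real.exp (-(r * x ^ 2))).aestronglyMeasurable
  have hA : Integrable (fun x => (p * x - K) * Real.exp (-(r * x ^ 2))) ν :=
    (hu.integrable (by norm_num)).mul_bdd hwm (.of_forall hw)
  have hsq : Integrable (fun x => max (p * x - K) 0 ^ 2) ν := by
    refine hu.integrable_sq.mono' (by fun_prop) (.of_forall fun x => ?_)
    rw [Real.norm_of_nonneg (by positivity)]
    rcases le_total (p * x - K) 0 with h | h <;> simp [h, sq_nonneg]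
  have hB : Integrable (fun x => max (p * x - K) 0 ^ 2 * Real.exp (-(r * x ^ 2))) ν :=
    hsq.mul_bdd hwm (.of_forall hw)
  have hBpos : 0 < ∫ x, max (p * x - K) 0 ^ 2 * Real.exp (-(r * x ^ 2)) ∂ν := by
    rw [integral_pos_iff_support_of_nonneg (fun x => by positivity) hB]
    refine lt_of_lt_of_le (pos_iff_ne_zero.2 hgt) (measure_mono fun x hx => ?_)
    have : 0 < p * x - K := sub_pos.2 hx
    simp only [Function.mem_support]
    rw [max_eq_left this.le]
    positivity
  set A := ∫ x, (p * x - K) * Real.exp (-(r * x ^ 2)) ∂ν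
  set B := ∫ x, max (p * x - K) 0 ^ 2 * Real.exp (-(r * x ^ 2)) ∂ν
  refine ⟨(|A| + 1) / B, ?_⟩
  set θ := (|A| + 1) / B with hθ
  have hθ0 : 0 ≤ θ := by positivity
  have hle : A + θ * B ≤ ∫ x, tiltedPayoff p K r θ x ∂ν := by
    rw [← integral_const_mul, ← integral_add hA (hB.const_mul θ)]
    refine integral_mono (hA.add (hB.const_mul θ)) (hint θ) fun x => ?_
    have := mul_le_mul_of_nonneg_right (le_mul_exp_mul (p * x - K) hθ0)
      (Real.exp_pos (-(r * x ^ 2))).le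
    simp only [tiltedPayoff]
    linarith
  have : θ * B = |A| + 1 := by rw [hθ]; field_simp
  linarith [neg_abs_le A]

lemma tiltedPayoff_neg (p K r θ x : ℝ) :
    tiltedPayoff (-p) (-K) r (-θ) x = -tiltedPayoff p K r θ x := by
  simp only [tiltedPayoff]
  rw [show (-p * x - -K) * -θ = (p * x - K) * θ by ring]
  ring

lemma exists_integral_tiltedPayoff_neg {ν : Measure ℝ} [IsFiniteMeasure ν]
    (hν : MemLp (fun x => x) 2 ν) {p K r : ℝ} (hr : 0 ≤ r)
    (hint : ∀ θ, Integrable (tiltedPayoff p K r θ) ν)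
    (hlt : ν {x | p * x < K} ≠ 0) : ∃ θ, ∫ x, tiltedPayoff p K r θ x ∂ν < 0 := by
  have hneg : ∀ θ, tiltedPayoff (-p) (-K) r θ = fun x => -tiltedPayoff p K r (-θ) x :=
    fun θ => funext fun x => by rw [← tiltedPayoff_neg, neg_neg]
  obtain ⟨θ, hθ⟩ := exists_integral_tiltedPayoff_pos (p := -p) (K := -K) hν hr
    (fun θ => by rw [hneg]; exact (hint _).neg) (by simpa using hlt)
  refine ⟨-θ, ?_⟩
  rw [hneg, integral_neg] at hθ
  linarith

section CriticalLevel

variable {ν : Measure ℝ} [IsProbabilityMeasure ν] {p K c s : ℝ}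

lemma integrable_tiltedPayoff (hν : Integrable (fun x => x) ν) (hp : 0 < p) (hc : 0 < c)
    (hs0 : 0 < s) (hs1 : s < 1) (θ : ℝ) :
    Integrable (tiltedPayoff p K (s / 2 / (c ^ 2 * (1 - s))) θ) ν := by
  have h1 : 0 < 1 - s := by linarith
  have h := (integrable_criticalIntegrand hν p K hc hs0 hs1
    (θ * (p * (c ^ 2 * (1 - s))))).const_mul (Real.exp (K * θ))⁻¹
  refine h.congr (.of_forall fun x => ?_)
  simp only
  rw [criticalIntegrand_eq_tiltedPayoff hp hc hs1, mul_div_cancel_right₀ _ (by positivity),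
    inv_mul_cancel_left₀ (Real.exp_pos _).ne']

omit [IsProbabilityMeasure ν] in
lemma integral_criticalIntegrand_eq_tilted (hp : 0 < p) (hc : 0 < c) (hs1 : s < 1) (z : ℝ) :
    ∫ x, criticalIntegrand p K c s z x ∂ν = Real.exp (K * (z / (p * (c ^ 2 * (1 - s))))) *
      ∫ x, tiltedPayoff p K (s / 2 / (c ^ 2 * (1 - s))) (z / (p * (c ^ 2 * (1 - s)))) x ∂ν := by
  simp_rw [criticalIntegrand_eq_tiltedPayoff hp hc hs1, integral_const_mul]

lemma integral_criticalIntegrand_pos (hν : Integrable (fun x => x) ν) (hp : 0 < p) (hc : 0 < c)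
    (hs0 : 0 < s) (hs1 : s < 1) (hgt : ν {x | K < p * x} ≠ 0) {z y : ℝ}
    (hz : ∫ x, criticalIntegrand p K c s z x ∂ν = 0) (hzy : z < y) :
    0 < ∫ x, criticalIntegrand p K c s y x ∂ν := by
  have h1 : 0 < 1 - s := by linarith
  rw [integral_criticalIntegrand_eq_tilted hp hc hs1] at hz ⊢
  have hz' := (mul_eq_zero.1 hz).resolve_left (Real.exp_pos _).ne'
  refine mul_pos (Real.exp_pos _) (hz'.symm.trans_lt ?_)
  exact strictMono_integral_tiltedPayoff (integrable_tiltedPayoff hν hp hc hs0 hs1) hgt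
    (by gcongr)

lemma integral_criticalIntegrand_neg (hν : Integrable (fun x => x) ν) (hp : 0 < p) (hc : 0 < c)
    (hs0 : 0 < s) (hs1 : s < 1) (hgt : ν {x | K < p * x} ≠ 0) {z y : ℝ}
    (hz : ∫ x, criticalIntegrand p K c s z x ∂ν = 0) (hzy : y < z) :
    ∫ x, criticalIntegrand p K c s y x ∂ν < 0 := by
  have h1 : 0 < 1 - s := by linarith
  rw [integral_criticalIntegrand_eq_tilted hp hc hs1] at hz ⊢
  have hz' := (mul_eq_zero.1 hz).resolve_left (Real.exp_pos _).ne'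
  refine mul_neg_of_pos_of_neg (Real.exp_pos _) (lt_of_lt_of_eq ?_ hz')
  exact strictMono_integral_tiltedPayoff (integrable_tiltedPayoff hν hp hc hs0 hs1) hgt
    (by gcongr)

lemma existsUnique_criticalLevel (hν : MemLp (fun x => x) 2 ν) (hp : 0 < p) (hc : 0 < c)
    (hs0 : 0 < s) (hs1 : s < 1) (hlt : ν {x | p * x < K} ≠ 0) (hgt : ν {x | K < p * x} ≠ 0) :
    ∃! z, ∫ x, criticalIntegrand p K c s z x ∂ν = 0 := by
  have h1 : 0 < 1 - s := by linarith
  have hν1 : Integrable (fun x => x) ν := hν.integrable (by norm_num)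
  have hint := integrable_tiltedPayoff (K := K) hν1 hp hc hs0 hs1
  have hr : 0 ≤ s / 2 / (c ^ 2 * (1 - s)) := by positivity
  have hκ : p * (c ^ 2 * (1 - s)) ≠ 0 := by positivity
  obtain ⟨θ, hθ⟩ := exists_integral_tiltedPayoff_pos hν hr hint hgt
  obtain ⟨η, hη⟩ := exists_integral_tiltedPayoff_neg hν hr hint hlt
  have hcont : Continuous fun z => ∫ x, criticalIntegrand p K c s z x ∂ν :=
    continuous_iff_continuousAt.2 fun z => tendsto_integral_mul_likelihood
      (f := fun x => p * x - K) ((hν1.const_mul p).sub (integrable_const K)) hc hs0 hs1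
      tendsto_const_nhds tendsto_id
  obtain ⟨z, hz⟩ := mem_range_of_exists_le_of_exists_ge hcont (c := 0)
    ⟨η * (p * (c ^ 2 * (1 - s))), by
      rw [integral_criticalIntegrand_eq_tilted hp hc hs1, mul_div_cancel_right₀ _ hκ]
      exact mul_nonpos_of_nonneg_of_nonpos (Real.exp_pos _).le hη.le⟩
    ⟨θ * (p * (c ^ 2 * (1 - s))), by
      rw [integral_criticalIntegrand_eq_tilted hp hc hs1, mul_div_cancel_right₀ _ hκ]
      exact mul_nonneg (Real.exp_pos _).le hθ.le⟩
  refine ⟨z, hz, fun y hy => ?_⟩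
  rcases lt_trichotomy y z with h | h | h
  · exact absurd hy (integral_criticalIntegrand_neg hν1 hp hc hs0 hs1 hgt hz h).ne
  · exact h
  · exact absurd hy (integral_criticalIntegrand_pos hν1 hp hc hs0 hs1 hgt hz h).ne'

end CriticalLevel

/-- The variance of the noise in an information process with volatility `c` at time `s`. -/
noncomputable def noiseVar (c s : ℝ) : NNReal := (c ^ 2 * (s * (1 - s))).toNNReal

lemma coe_noiseVar {s : ℝ} (c : ℝ) (hs0 : 0 < s) (hs1 : s < 1) :
    (noiseVar c s : ℝ) = c ^ 2 * (s * (1 - s)) := by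
  have h1 : 0 < 1 - s := by linarith
  exact Real.coe_toNNReal _ (by positivity)

lemma noiseVar_ne_zero {c s : ℝ} (hc : 0 < c) (hs0 : 0 < s) (hs1 : s < 1) : noiseVar c s ≠ 0 := by
  have h1 : 0 < 1 - s := by linarith
  rw [← NNReal.coe_ne_zero, coe_noiseVar c hs0 hs1]
  positivity

lemma gaussianPDF_sub_eq {c s : ℝ} (hc : 0 < c) (hs0 : 0 < s) (hs1 : s < 1) (x y : ℝ) :
    gaussianPDF 0 (noiseVar c s) (y - s * x) =
      gaussianPDF 0 (noiseVar c s) y * ENNReal.ofReal (likelihood c s y x) := by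
  have h1 : 0 < 1 - s := by linarith
  rw [gaussianPDF, gaussianPDF, ← ENNReal.ofReal_mul (gaussianPDFReal_nonneg _ _ _)]
  congr 1
  rw [gaussianPDFReal, gaussianPDFReal, likelihood, mul_assoc (_⁻¹), ← Real.exp_add,
    coe_noiseVar c hs0 hs1]
  congr 2
  field_simp
  ring

lemma lintegral_gaussianReal_add {c s : ℝ} (hc : 0 < c) (hs0 : 0 < s) (hs1 : s < 1)
    {f : ℝ → ENNReal} (hf : Measurable f) (x : ℝ) :
    ∫⁻ b, f (s * x + b) ∂(gaussianReal 0 (noiseVar c s)) =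
      ∫⁻ y, ENNReal.ofReal (likelihood c s y x) * f y ∂(gaussianReal 0 (noiseVar c s)) := by
  have hl : Measurable fun y => likelihood c s y x := by unfold likelihood; fun_prop
  rw [gaussianReal_of_var_ne_zero _ (noiseVar_ne_zero hc hs0 hs1),
    lintegral_withDensity_eq_lintegral_mul _ (measurable_gaussianPDF _ _) (by fun_prop),
    lintegral_withDensity_eq_lintegral_mul _ (measurable_gaussianPDF _ _) (by fun_prop)]
  conv_rhs => rw [← lintegral_add_left_eq_self _ (s * x)]
  refine lintegral_congr fun b => ?_
  have h := gaussianPDF_sub_eq hc hs0 hs1 x (s * x + b)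
  rw [add_sub_cancel_left] at h
  simp only [Pi.mul_apply, h, mul_assoc]

section Bayes

variable {Ω : Type*} [MeasurableSpace Ω] {μ : Measure Ω} [IsProbabilityMeasure μ]
  {X b : Ω → ℝ} {c s : ℝ}

/-- Bayes' formula: the joint law of the signal and of the information process. -/
lemma map_prodMk_level (hX : Measurable X) (hb : Measurable b) (hXb : IndepFun X b μ)
    (hlaw : μ.map b = gaussianReal 0 (noiseVar c s)) (hc : 0 < c) (hs0 : 0 < s) (hs1 : s < 1) :
    μ.map (fun ω => (X ω, s * X ω + b ω)) =
      ((μ.map X).prod (gaussianReal 0 (noiseVar c s))).withDensity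
        fun q => ENNReal.ofReal (likelihood c s q.2 q.1) := by
  have : IsProbabilityMeasure (μ.map X) := Measure.isProbabilityMeasure_map hX.aemeasurable
  have hl : Measurable fun q : ℝ × ℝ => likelihood c s q.2 q.1 := measurable_likelihood_uncurry c s
  refine Measure.ext_of_lintegral _ fun f hf => ?_
  have hpair := (indepFun_iff_map_prod_eq_prod_map_map hX.aemeasurable hb.aemeasurable).1 hXb
  rw [hlaw] at hpair
  rw [lintegral_map hf (by fun_prop), lintegral_withDensity_eq_lintegral_mul _ (by fun_prop) hf,
    lintegral_prod _ (by fun_prop)]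
  calc ∫⁻ ω, f (X ω, s * X ω + b ω) ∂μ
      = ∫⁻ q, f (q.1, s * q.1 + q.2) ∂(μ.map fun ω => (X ω, b ω)) := by
        rw [lintegral_map (by fun_prop) (by fun_prop)]
    _ = ∫⁻ x, ∫⁻ y, f (x, s * x + y) ∂(gaussianReal 0 (noiseVar c s)) ∂(μ.map X) := by
        rw [hpair, lintegral_prod _ (by fun_prop)]
    _ = _ := by
        refine lintegral_congr fun x => ?_
        rw [lintegral_gaussianReal_add hc hs0 hs1 (f := fun y => f (x, y)) (by fun_prop)]
        rfl

lemma integral_comp_level (hX : Measurable X) (hb : Measurable b) (hXb : IndepFun X b μ)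
    (hlaw : μ.map b = gaussianReal 0 (noiseVar c s)) (hc : 0 < c) (hs0 : 0 < s) (hs1 : s < 1)
    {F : ℝ × ℝ → ℝ} (hF : Measurable F) :
    ∫ ω, F (X ω, s * X ω + b ω) ∂μ = ∫ q, likelihood c s q.2 q.1 * F q
      ∂((μ.map X).prod (gaussianReal 0 (noiseVar c s))) := by
  have hl := measurable_likelihood_uncurry c s
  rw [← integral_map (f := F) (by fun_prop) hF.aestronglyMeasurable,
    map_prodMk_level hX hb hXb hlaw hc hs0 hs1,
    integral_withDensity_eq_integral_toReal_smul (by fun_prop) (by simp)]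
  simp [ENNReal.toReal_ofReal (likelihood_pos ..).le]

lemma integrable_comp_level_iff (hX : Measurable X) (hb : Measurable b) (hXb : IndepFun X b μ)
    (hlaw : μ.map b = gaussianReal 0 (noiseVar c s)) (hc : 0 < c) (hs0 : 0 < s) (hs1 : s < 1)
    {F : ℝ × ℝ → ℝ} (hF : Measurable F) :
    Integrable (fun ω => F (X ω, s * X ω + b ω)) μ ↔
      Integrable (fun q => likelihood c s q.2 q.1 * F q)
        ((μ.map X).prod (gaussianReal 0 (noiseVar c s))) := by
  have hl := measurable_likelihood_uncurry c s
  have h := integrable_map_measure (μ := μ) (f := fun ω => (X ω, s * X ω + b ω)) (g := F)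
    hF.aestronglyMeasurable (by fun_prop)
  rw [map_prodMk_level hX hb hXb hlaw hc hs0 hs1,
    integrable_withDensity_iff_integrable_smul' (by fun_prop) (by simp)] at h
  simpa [ENNReal.toReal_ofReal (likelihood_pos ..).le, Function.comp_def] using h.symm

lemma integrable_posteriorMean_level (hX : Measurable X) (hXi : Integrable X μ) (hb : Measurable b)
    (hXb : IndepFun X b μ) (hlaw : μ.map b = gaussianReal 0 (noiseVar c s))
    (hc : 0 < c) (hs0 : 0 < s) (hs1 : s < 1) :
    Integrable (fun ω => posteriorMean (μ.map X) c s (s * X ω + b ω)) μ := by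
  have : IsProbabilityMeasure (μ.map X) := Measure.isProbabilityMeasure_map hX.aemeasurable
  have hl := measurable_likelihood_uncurry c s
  have h1 := (integrable_comp_level_iff hX hb hXb hlaw hc hs0 hs1 measurable_fst).1 hXi
  rw [integrable_comp_level_iff (F := fun q => posteriorMean (μ.map X) c s q.2) hX hb hXb hlaw
    hc hs0 hs1 (by fun_prop), integrable_prod_iff' (by fun_prop)]
  refine ⟨.of_forall fun y => (integrable_likelihood hc hs0 hs1 y).mul_const
    (posteriorMean (μ.map X) c s y), ?_⟩
  refine h1.swap.integral_prod_left.abs.congr (.of_forall fun y => ?_)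
  have h0 := integral_likelihood_pos (ν := μ.map X) hc hs0 hs1 y
  simp only [norm_mul, Real.norm_of_nonneg (likelihood_pos ..).le, Real.norm_eq_abs,
    integral_mul_const, posteriorMean, Function.comp, Prod.swap, abs_div]
  rw [abs_of_pos h0, mul_div_cancel₀ _ h0.ne']
  simp_rw [mul_comm]

lemma setIntegral_posteriorMean_level (hX : Measurable X) (hXi : Integrable X μ)
    (hb : Measurable b) (hXb : IndepFun X b μ) (hlaw : μ.map b = gaussianReal 0 (noiseVar c s))
    (hc : 0 < c) (hs0 : 0 < s) (hs1 : s < 1) {C : Set ℝ} (hC : MeasurableSet C) :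
    ∫ ω in {ω | s * X ω + b ω ∈ C}, posteriorMean (μ.map X) c s (s * X ω + b ω) ∂μ =
      ∫ ω in {ω | s * X ω + b ω ∈ C}, X ω ∂μ := by
  have : IsProbabilityMeasure (μ.map X) := Measure.isProbabilityMeasure_map hX.aemeasurable
  have hl := measurable_likelihood_uncurry c s
  have hCm : MeasurableSet {ω | s * X ω + b ω ∈ C} :=
    (by fun_prop : Measurable fun ω => s * X ω + b ω) hC
  set g : ℝ × ℝ → ℝ := fun q => C.indicator (fun y => posteriorMean (μ.map X) c s y) q.2 with hg
  set f : ℝ × ℝ → ℝ := fun q => C.indicator (fun _ => q.1) q.2 with hf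
  have hgm : Measurable g := by
    exact ((measurable_posteriorMean _ c s).indicator hC).comp measurable_snd
  have hfm : Measurable f := by
    have : f = (Prod.snd ⁻¹' C).indicator Prod.fst := rfl
    rw [this]
    exact measurable_fst.indicator (measurable_snd hC)
  have hgi : Integrable (fun ω => g (X ω, s * X ω + b ω)) μ :=
    (integrable_posteriorMean_level hX hXi hb hXb hlaw hc hs0 hs1).indicator hCm
  have hfi : Integrable (fun ω => f (X ω, s * X ω + b ω)) μ := hXi.indicator hCm
  rw [← integral_indicator hCm, ← integral_indicator hCm]
  change ∫ ω, g (X ω, s * X ω + b ω) ∂μ = ∫ ω, f (X ω, s * X ω + b ω) ∂μ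
  rw [integrable_comp_level_iff hX hb hXb hlaw hc hs0 hs1 hgm] at hgi
  rw [integrable_comp_level_iff hX hb hXb hlaw hc hs0 hs1 hfm] at hfi
  rw [integral_comp_level hX hb hXb hlaw hc hs0 hs1 hgm,
    integral_comp_level hX hb hXb hlaw hc hs0 hs1 hfm, integral_prod_symm _ hgi,
    integral_prod_symm _ hfi]
  refine integral_congr_ae (.of_forall fun y => ?_)
  have h0 := integral_likelihood_pos (ν := μ.map X) hc hs0 hs1 y
  by_cases hy : y ∈ C
  · simp only [hg, hf, indicator_of_mem hy, integral_mul_const, posteriorMean]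
    rw [mul_div_cancel₀ _ h0.ne']
    simp_rw [mul_comm]
  · simp [hg, hf, hy]

lemma gaussianReal_Ioi {c s : ℝ} (hc : 0 < c) (hs0 : 0 < s) (hs1 : s < 1) (z x : ℝ) :
    (gaussianReal 0 (noiseVar c s)).real (Ioi (z - s * x)) = exerciseProb c s z x := by
  have h1 : 0 < 1 - s := by linarith
  have hd : 0 < c * √(s * (1 - s)) := by positivity
  have hmap : gaussianReal 0 (noiseVar c s) =
      (gaussianReal 0 1).map fun w => -(c * √(s * (1 - s))) * w := by
    rw [gaussianReal_map_const_mul, mul_zero, mul_one]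
    congr 1
    rw [← NNReal.coe_inj, coe_noiseVar c hs0 hs1, NNReal.coe_mk, neg_sq, mul_pow,
      Real.sq_sqrt (by positivity)]
  rw [exerciseProb, stdNormalCDF, cdf_eq_real, hmap,
    map_measureReal_apply (by fun_prop) measurableSet_Ioi]
  have heq : -(z / (c * √(s * (1 - s)))) + x * √s / (c * √(1 - s)) =
      -(z - s * x) / (c * √(s * (1 - s))) := by
    rw [Real.sqrt_mul hs0.le]
    have h2 := Real.sqrt_pos.2 hs0
    have h3 := Real.sqrt_pos.2 h1
    field_simp
    linear_combination x * Real.sq_sqrt hs0.le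
  rw [heq]
  have hset : (fun w => -(c * √(s * (1 - s))) * w) ⁻¹' Ioi (z - s * x) =
      Iio (-(z - s * x) / (c * √(s * (1 - s)))) := by
    ext w
    simp only [mem_preimage, mem_Ioi, mem_Iio]
    rw [lt_div_iff₀ hd]
    constructor <;> intro h <;> linarith
  have := nullSingletonClass_gaussianReal (μ := 0) (v := 1) one_ne_zero
  rw [hset]
  exact measureReal_congr Iio_ae_eq_Iic

end Bayes

section Independence

variable {Ω : Type*} [MeasurableSpace Ω] {μ : Measure Ω}

lemma IndepFun.prodMk_left_of_prodMk_right [IsProbabilityMeasure μ] {α β γ : Type*}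
    [MeasurableSpace α] [MeasurableSpace β] [MeasurableSpace γ] {U : Ω → α} {V : Ω → β} {W : Ω → γ}
    (hU : Measurable U) (hV : Measurable V) (hW : Measurable W)
    (h1 : IndepFun U (fun ω => (V ω, W ω)) μ) (h2 : IndepFun V W μ) :
    IndepFun (fun ω => (U ω, V ω)) W μ := by
  have := Measure.isProbabilityMeasure_map (μ := μ) hU.aemeasurable
  have := Measure.isProbabilityMeasure_map (μ := μ) hV.aemeasurable
  have := Measure.isProbabilityMeasure_map (μ := μ) hW.aemeasurable
  have h3 : IndepFun U V μ := h1.comp measurable_id measurable_fst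
  rw [indepFun_iff_map_prod_eq_prod_map_map (by fun_prop) (by fun_prop)] at h1 h2 h3 ⊢
  rw [h3, ← MeasurableEquiv.prodAssoc.map_measurableEquiv_injective.eq_iff, Measure.prodAssoc_prod,
    ← h2, ← h1, Measure.map_map (by fun_prop) (by fun_prop)]
  rfl

lemma setIntegral_comp_of_indepFun [IsProbabilityMeasure μ] {α β : Type*}
    [MeasurableSpace α] [MeasurableSpace β] {H : Ω → α} {Z : Ω → β} (hH : Measurable H)
    (hZ : Measurable Z) (h : IndepFun H Z μ) {F : β → ℝ} (hF : Measurable F)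
    (hFi : Integrable (fun ω => F (Z ω)) μ) {B : Set (α × β)} (hB : MeasurableSet B) :
    ∫ ω in {ω | (H ω, Z ω) ∈ B}, F (Z ω) ∂μ =
      ∫ a, ∫ ω in {ω | (a, Z ω) ∈ B}, F (Z ω) ∂μ ∂(μ.map H) := by
  have := Measure.isProbabilityMeasure_map (μ := μ) hH.aemeasurable
  have := Measure.isProbabilityMeasure_map (μ := μ) hZ.aemeasurable
  have hHZ : Measurable fun ω => (H ω, Z ω) := hH.prodMk hZ
  have hFZ : Integrable F (μ.map Z) :=
    (integrable_map_measure hF.aestronglyMeasurable hZ.aemeasurable).2 hFi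
  have hG : Measurable (B.indicator fun q => F q.2) := (hF.comp measurable_snd).indicator hB
  have hGi : Integrable (B.indicator fun q => F q.2) ((μ.map H).prod (μ.map Z)) :=
    (hFZ.comp_snd (μ.map H)).indicator hB
  have hprod := (indepFun_iff_map_prod_eq_prod_map_map hH.aemeasurable hZ.aemeasurable).1 h
  calc ∫ ω in {ω | (H ω, Z ω) ∈ B}, F (Z ω) ∂μ
      = ∫ ω, B.indicator (fun q => F q.2) (H ω, Z ω) ∂μ := by
        have hE : MeasurableSet {ω | (H ω, Z ω) ∈ B} := hHZ hB
        rw [← integral_indicator hE]; rfl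
    _ = ∫ q, B.indicator (fun q => F q.2) q ∂((μ.map H).prod (μ.map Z)) := by
        rw [← hprod, integral_map hHZ.aemeasurable hG.aestronglyMeasurable]
    _ = ∫ a, ∫ b, B.indicator (fun q => F q.2) (a, b) ∂(μ.map Z) ∂(μ.map H) :=
        integral_prod _ hGi
    _ = _ := by
        refine integral_congr_ae (.of_forall fun a => ?_)
        have haB : MeasurableSet {ω | (a, Z ω) ∈ B} := (measurable_const.prodMk hZ) hB
        simp only
        rw [← integral_indicator haB,
          integral_map (f := fun b => B.indicator (fun q => F q.2) (a, b))
          hZ.aemeasurable (hG.comp measurable_prodMk_left).aestronglyMeasurable]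
        rfl

/-- Enlarging the observation of `Y` by some information `H` that is independent of `(X, Y)` does
not change the conditional expectation of `X`. -/
lemma setIntegral_eq_of_indepFun_prodMk [IsProbabilityMeasure μ] {α : Type*} [MeasurableSpace α]
    {H : Ω → α} {X Y : Ω → ℝ} (hH : Measurable H) (hX : Measurable X) (hY : Measurable Y)
    (h : IndepFun H (fun ω => (X ω, Y ω)) μ) {g : ℝ → ℝ} (hg : Measurable g)
    (hXi : Integrable X μ) (hgi : Integrable (fun ω => g (Y ω)) μ)
    (heq : ∀ C, MeasurableSet C → ∫ ω in {ω | Y ω ∈ C}, g (Y ω) ∂μ = ∫ ω in {ω | Y ω ∈ C}, X ω ∂μ)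
    {B : Set (α × ℝ)} (hB : MeasurableSet B) :
    ∫ ω in {ω | (H ω, Y ω) ∈ B}, g (Y ω) ∂μ = ∫ ω in {ω | (H ω, Y ω) ∈ B}, X ω ∂μ := by
  have hB' : MeasurableSet {q : α × ℝ × ℝ | (q.1, q.2.2) ∈ B} :=
    (by fun_prop : Measurable fun q : α × ℝ × ℝ => (q.1, q.2.2)) hB
  have h1 := setIntegral_comp_of_indepFun hH (hX.prodMk hY) h (F := fun q => q.1) measurable_fst
    hXi hB'
  have h2 := setIntegral_comp_of_indepFun hH (hX.prodMk hY) h (F := fun q => g q.2)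
    (hg.comp measurable_snd) hgi hB'
  simp only [mem_ofPred_eq] at h1 h2
  rw [h1, h2]
  refine integral_congr_ae (.of_forall fun a => ?_)
  exact heq {y | (a, y) ∈ B} (measurable_prodMk_left hB)

end Independence

section Gaussian

variable {Ω : Type*} [MeasurableSpace Ω] {μ : Measure Ω}

lemma isGaussianProcess_uncurry {ι T : Type*} [Fintype ι] {B : ι → T → Ω → ℝ}
    (hB : ∀ i, IsGaussianProcess (B i) μ)
    (hind : iIndepFun (fun i ω t => B i t ω) μ) :
    IsGaussianProcess (fun q : ι × T => B q.1 q.2) μ where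
  hasGaussianLaw I := by
    classical
    let S : Finset T := I.image Prod.snd
    have h1 : iIndepFun (fun i ω => S.restrict (B i · ω)) μ :=
      hind.comp (fun i (f : T → ℝ) => S.restrict f) (fun i => by fun_prop)
    have h2 := h1.hasGaussianLaw fun i => (hB i).hasGaussianLaw S
    let L : (ι → S → ℝ) →L[ℝ] (I → ℝ) := ContinuousLinearMap.pi fun q =>
      (ContinuousLinearMap.proj (R := ℝ) (φ := fun _ : S => ℝ)
        ⟨q.1.2, Finset.mem_image_of_mem _ q.2⟩).comp
          (ContinuousLinearMap.proj (R := ℝ) (φ := fun _ : ι => S → ℝ) q.1.1)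
    exact h2.map L

lemma IsGaussianProcess.of_mem_span {S T : Type*} {Z : T → Ω → ℝ} (hZ : IsGaussianProcess Z μ)
    {Y : S → Ω → ℝ} (hY : ∀ s, Y s ∈ Submodule.span ℝ (range Z)) : IsGaussianProcess Y μ := by
  refine hZ.of_isGaussianProcess fun s => ?_
  obtain ⟨a, ha⟩ := Finsupp.mem_span_range_iff_exists_finsupp.1 (hY s)
  refine ⟨a.support, ∑ q : a.support, a q • ContinuousLinearMap.proj q, fun ω => ?_⟩
  rw [← ha, Finsupp.sum, Finset.sum_apply, ← Finset.sum_coe_sort]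
  simp

end Gaussian

section CallPrice

variable {Ω : Type*} [MeasurableSpace Ω] {μ : Measure Ω} [IsProbabilityMeasure μ]
  {X b : Ω → ℝ} {c s : ℝ}

lemma measurable_exerciseProb (c s z : ℝ) : Measurable (exerciseProb c s z) :=
  (monotone_cdf (gaussianReal 0 1)).measurable.comp (by fun_prop)

lemma norm_exerciseProb_le (c s z x : ℝ) : ‖exerciseProb c s z x‖ ≤ 1 := by
  rw [exerciseProb, stdNormalCDF, Real.norm_of_nonneg (cdf_nonneg _ _)]
  exact cdf_le_one _ _

lemma integrable_mul_exerciseProb {ν : Measure ℝ} {f : ℝ → ℝ} (hf : Integrable f ν) (c s z : ℝ) :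
    Integrable (fun x => f x * exerciseProb c s z x) ν :=
  hf.mul_bdd (measurable_exerciseProb c s z).aestronglyMeasurable
    (.of_forall (norm_exerciseProb_le c s z))

lemma integrable_exerciseProb {ν : Measure ℝ} [IsFiniteMeasure ν] (c s z : ℝ) :
    Integrable (exerciseProb c s z) ν := by
  simpa using integrable_mul_exerciseProb (integrable_const (1 : ℝ)) c s z

lemma setIntegral_level_gt (hX : Measurable X) (hb : Measurable b)
    (hXb : IndepFun X b μ) (hlaw : μ.map b = gaussianReal 0 (noiseVar c s))
    (hc : 0 < c) (hs0 : 0 < s) (hs1 : s < 1) {f : ℝ → ℝ} (hf : Measurable f)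
    (hfi : Integrable (fun ω => f (X ω)) μ) (z : ℝ) :
    ∫ ω in {ω | s * X ω + b ω ∈ Ioi z}, f (X ω) ∂μ =
      ∫ x, f x * exerciseProb c s z x ∂(μ.map X) := by
  have := Measure.isProbabilityMeasure_map (μ := μ) hX.aemeasurable
  have hpair := (indepFun_iff_map_prod_eq_prod_map_map hX.aemeasurable hb.aemeasurable).1 hXb
  rw [hlaw] at hpair
  set E : Set (ℝ × ℝ) := {q | s * q.1 + q.2 ∈ Ioi z}
  have hE : MeasurableSet E := (by fun_prop : Measurable fun q : ℝ × ℝ => s * q.1 + q.2)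
    measurableSet_Ioi
  have hEm : MeasurableSet {ω | s * X ω + b ω ∈ Ioi z} :=
    (by fun_prop : Measurable fun ω => s * X ω + b ω) measurableSet_Ioi
  have hG : Measurable (E.indicator fun q => f q.1) := (hf.comp measurable_fst).indicator hE
  have hfX : Integrable f (μ.map X) :=
    (integrable_map_measure hf.aestronglyMeasurable hX.aemeasurable).2 hfi
  calc ∫ ω in {ω | s * X ω + b ω ∈ Ioi z}, f (X ω) ∂μ
      = ∫ ω, E.indicator (fun q => f q.1) (X ω, b ω) ∂μ := by
        rw [← integral_indicator hEm]; rfl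
    _ = ∫ q, E.indicator (fun q => f q.1) q
          ∂((μ.map X).prod (gaussianReal 0 (noiseVar c s))) := by
        rw [← hpair, integral_map (by fun_prop) hG.aestronglyMeasurable]
    _ = ∫ x, ∫ y, E.indicator (fun q => f q.1) (x, y) ∂(gaussianReal 0 (noiseVar c s))
          ∂(μ.map X) := integral_prod _ ((hfX.comp_fst _).indicator hE)
    _ = _ := by
        refine integral_congr_ae (.of_forall fun x => ?_)
        have : (fun y => E.indicator (fun q => f q.1) (x, y)) =
            (Ioi (z - s * x)).indicator fun _ => f x := by
          ext y
          simp only [indicator, E, mem_ofPred_eq, mem_Ioi, sub_lt_iff_lt_add']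
        simp only
        rw [this, integral_indicator_const _ measurableSet_Ioi, gaussianReal_Ioi hc hs0 hs1,
          smul_eq_mul, mul_comm]

lemma integral_call_level (hX : Measurable X) (hXi : Integrable X μ) (hb : Measurable b)
    (hXb : IndepFun X b μ) (hlaw : μ.map b = gaussianReal 0 (noiseVar c s))
    (hc : 0 < c) (hs0 : 0 < s) (hs1 : s < 1) {p K z : ℝ} (hp : 0 < p)
    (hgt : μ {ω | K < p * X ω} ≠ 0)
    (hz : ∫ x, criticalIntegrand p K c s z x ∂(μ.map X) = 0) :
    ∫ ω, max (p * posteriorMean (μ.map X) c s (s * X ω + b ω) - K) 0 ∂μ =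
      p * ∫ x, x * exerciseProb c s z x ∂(μ.map X) - K * ∫ x, exerciseProb c s z x ∂(μ.map X) := by
  have := Measure.isProbabilityMeasure_map (μ := μ) hX.aemeasurable
  have hν : Integrable (fun x => x) (μ.map X) :=
    (integrable_map_measure aestronglyMeasurable_id hX.aemeasurable).2 hXi
  have hgt' : μ.map X {x | K < p * x} ≠ 0 := by
    rwa [Measure.map_apply hX (measurableSet_lt (by fun_prop) (by fun_prop))]
  have hEm : MeasurableSet {ω | s * X ω + b ω ∈ Ioi z} :=
    (by fun_prop : Measurable fun ω => s * X ω + b ω) measurableSet_Ioi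
  have hg := integrable_posteriorMean_level hX hXi hb hXb hlaw hc hs0 hs1
  have hmax : ∀ y, max (p * posteriorMean (μ.map X) c s y - K) 0 =
      (Ioi z).indicator (fun y => p * posteriorMean (μ.map X) c s y - K) y := by
    intro y
    have hL := integral_likelihood_pos (ν := μ.map X) hc hs0 hs1 y
    have hy := integral_criticalIntegrand (ν := μ.map X) hν p K hc hs0 hs1 y
    rcases lt_trichotomy y z with h | h | h
    · have := integral_criticalIntegrand_neg hν hp hc hs0 hs1 hgt' hz h
      rw [hy] at this
      rw [indicator_of_notMem (by simpa using h.le), max_eq_right]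
      exact (neg_of_mul_neg_left this hL.le).le
    · subst h
      rw [hz] at hy
      rw [indicator_of_notMem (by simp), (mul_eq_zero.1 hy.symm).resolve_right hL.ne', max_self]
    · have := integral_criticalIntegrand_pos hν hp hc hs0 hs1 hgt' hz h
      rw [hy] at this
      rw [indicator_of_mem (mem_Ioi.2 h), max_eq_left]
      exact (pos_of_mul_pos_left this hL.le).le
  calc ∫ ω, max (p * posteriorMean (μ.map X) c s (s * X ω + b ω) - K) 0 ∂μ
      = ∫ ω in {ω | s * X ω + b ω ∈ Ioi z},
          (p * posteriorMean (μ.map X) c s (s * X ω + b ω) - K) ∂μ := by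
        simp_rw [hmax]; rw [← integral_indicator hEm]; rfl
    _ = p * ∫ ω in {ω | s * X ω + b ω ∈ Ioi z}, X ω ∂μ -
          K * ∫ ω in {ω | s * X ω + b ω ∈ Ioi z}, 1 ∂μ := by
        rw [integral_sub (hg.integrableOn.const_mul p) (integrable_const K), integral_const_mul,
          setIntegral_posteriorMean_level hX hXi hb hXb hlaw hc hs0 hs1 measurableSet_Ioi,
          ← integral_const_mul K]
        simp
    _ = _ := by
        rw [setIntegral_level_gt (f := fun x => x) hX hb hXb hlaw hc hs0 hs1 measurable_id hXi,
          setIntegral_level_gt (f := fun _ => 1) hX hb hXb hlaw hc hs0 hs1 measurable_const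
            (integrable_const 1)]
        simp

end CallPrice

section EffectiveVolatility

variable {n : ℕ} {σ : Fin n → ℝ} {k : Fin n → Bool}

lemma sum_inv_sq_pos (hσ : ∀ i, 0 < σ i) (hk : ∃ i, k i = true) :
    0 < ∑ i with k i = true, (σ i ^ 2)⁻¹ := by
  obtain ⟨i, hi⟩ := hk
  exact Finset.sum_pos (fun j _ => inv_pos.2 (pow_pos (hσ j) 2)) ⟨i, by simpa using hi⟩

lemma effVol_pos (hσ : ∀ i, 0 < σ i) (hk : ∃ i, k i = true) : 0 < effVol σ k :=
  inv_pos.2 (Real.sqrt_pos.2 (sum_inv_sq_pos hσ hk))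

lemma effVol_sq_mul_sum (hσ : ∀ i, 0 < σ i) (hk : ∃ i, k i = true) :
    effVol σ k ^ 2 * ∑ i with k i = true, (σ i ^ 2)⁻¹ = 1 := by
  have h := sum_inv_sq_pos hσ hk
  rw [effVol, inv_pow, Real.sq_sqrt h.le, inv_mul_cancel₀ h.ne']

/-- The precision weighted average of the levels of the active sources. -/
noncomputable def aggLevel (σ : Fin n → ℝ) (k : Fin n → Bool) (v : Fin n → ℝ) : ℝ :=
  ∑ i with k i = true, effVol σ k ^ 2 / σ i ^ 2 * v i

/-- The precision weighted average of the noise terms of the active sources. -/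
noncomputable def aggNoise (σ : Fin n → ℝ) (k : Fin n → Bool) (w : Fin n → ℝ) : ℝ :=
  aggLevel σ k fun i => σ i * w i

@[fun_prop]
lemma continuous_aggLevel (σ : Fin n → ℝ) (k : Fin n → Bool) : Continuous (aggLevel σ k) := by
  unfold aggLevel; fun_prop

@[fun_prop]
lemma measurable_aggLevel (σ : Fin n → ℝ) (k : Fin n → Bool) : Measurable (aggLevel σ k) :=
  (continuous_aggLevel σ k).measurable

@[fun_prop]
lemma measurable_aggNoise (σ : Fin n → ℝ) (k : Fin n → Bool) : Measurable (aggNoise σ k) := by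
  unfold aggNoise; fun_prop

lemma aggLevel_infoProcess (hσ : ∀ i, 0 < σ i) (hk : ∃ i, k i = true) {Ω : Type*} (X : Ω → ℝ)
    (β : Fin n → unitInterval → Ω → ℝ) (s : unitInterval) (ω : Ω) :
    aggLevel σ k (fun i => infoProcess X σ β i s ω) =
      s * X ω + aggNoise σ k (fun i => β i s ω) := by
  simp only [aggLevel, aggNoise, infoProcess, mul_add, Finset.sum_add_distrib]
  rw [← Finset.sum_mul]
  simp_rw [div_eq_mul_inv]
  rw [← Finset.mul_sum, effVol_sq_mul_sum hσ hk, one_mul]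

lemma aggLevel_congr {v w : Fin n → ℝ} (h : ∀ i, k i = true → v i = w i) :
    aggLevel σ k v = aggLevel σ k w :=
  Finset.sum_congr rfl fun i hi => by rw [h i (by simpa using hi)]

end EffectiveVolatility

/-- The data of the model: a signal, information processes driven by independent Brownian bridges,
and an independent càdlàg process of activity states. -/
structure IsInfoModel {Ω : Type*} [MeasurableSpace Ω] (μ : Measure Ω) {n : ℕ} (X : Ω → ℝ)
    (σ : Fin n → ℝ) (β : Fin n → unitInterval → Ω → ℝ) (J : unitInterval → Ω → Fin n → Bool) :
    Prop where
  measurable_signal : Measurable X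
  memLp_signal : MemLp X 2 μ
  vol_pos : ∀ i, 0 < σ i
  bridge : ∀ i, IsBrownianBridge (β i) μ
  bridge_indep : iIndepFun (fun i ω t => β i t ω) μ
  signal_indep : IndepFun X (fun ω i t => β i t ω) μ
  measurable_state : ∀ t, Measurable (J t)
  cadlag : ∀ ω, IsCadlag fun t => J t ω
  state_indep : IndepFun (fun ω t => J t ω) (fun ω i t => infoProcess X σ β i t ω) μ
  mono : ∀ᵐ ω ∂μ, ∀ i, ∀ s u : unitInterval, s ≤ u → J s ω i = true → J u ω i = true
  start : ∀ᵐ ω ∂μ, ∃ i, J 0 ω i = true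

namespace IsInfoModel

set_option linter.unusedSectionVars false

variable {Ω : Type*} [MeasurableSpace Ω] {μ : Measure Ω} [IsProbabilityMeasure μ] {n : ℕ}
  {X : Ω → ℝ} {σ : Fin n → ℝ} {β : Fin n → unitInterval → Ω → ℝ}
  {J : unitInterval → Ω → Fin n → Bool} (M : IsInfoModel μ X σ β J)
include M

lemma integrable_signal : Integrable X μ := M.memLp_signal.integrable (by norm_num)

lemma measurable_bridge (i : Fin n) (t : unitInterval) : Measurable (β i t) :=
  (M.bridge i).measurable t

lemma memLp_bridge (i : Fin n) (t : unitInterval) : MemLp (β i t) 2 μ :=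
  ((M.bridge i).gaussian.hasGaussianLaw_eval t).memLp_two

lemma measurable_info (i : Fin n) (t : unitInterval) :
    Measurable (infoProcess X σ β i t) :=
  (M.measurable_signal.const_mul _).add ((M.measurable_bridge i t).const_mul _)

lemma covariance_bridge (i j : Fin n) (s t : unitInterval) :
    cov[β i s, β j t; μ] = if i = j then min (s : ℝ) t - s * t else 0 := by
  split_ifs with h
  · subst h; exact (M.bridge i).covariance s t
  · exact ((M.bridge_indep.indepFun h).comp (measurable_pi_apply s)
      (measurable_pi_apply t)).covariance_eq_zero (M.memLp_bridge i s) (M.memLp_bridge j t)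

lemma memLp_aggNoise (k : Fin n → Bool) (s : unitInterval) :
    MemLp (fun ω => aggNoise σ k fun i => β i s ω) 2 μ := by
  unfold aggNoise aggLevel
  exact memLp_finsetSum _ fun i _ => ((M.memLp_bridge i s).const_mul _).const_mul _

lemma covariance_bridge_aggNoise {k : Fin n → Bool} {i : Fin n} (hi : k i = true)
    {u s : unitInterval} (hus : u ≤ s) :
    cov[β i u, fun ω => aggNoise σ k (fun j => β j s ω); μ] =
      effVol σ k ^ 2 / σ i * (u - u * s) := by
  have hσ := (M.vol_pos i).ne'
  unfold aggNoise aggLevel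
  rw [covariance_fun_sum_right' (fun j _ => ((M.memLp_bridge j s).const_mul _).const_mul _)
    (M.memLp_bridge i u)]
  simp_rw [covariance_const_mul_right, M.covariance_bridge]
  rw [Finset.sum_eq_single i (fun j _ hj => by simp [hj.symm]) (by simp [hi])]
  rw [if_pos rfl, min_eq_left (by exact_mod_cast hus)]
  field_simp

lemma variance_aggNoise {k : Fin n → Bool} (hk : ∃ i, k i = true) (s : unitInterval) :
    cov[fun ω => aggNoise σ k (fun j => β j s ω), fun ω => aggNoise σ k (fun j => β j s ω); μ] =
      effVol σ k ^ 2 * (s * (1 - s)) := by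
  have h1 : cov[fun ω => aggNoise σ k (fun j => β j s ω),
      fun ω => aggNoise σ k (fun j => β j s ω); μ] =
      ∑ i with k i = true, effVol σ k ^ 2 / σ i ^ 2 * (σ i *
        cov[β i s, fun ω => aggNoise σ k (fun j => β j s ω); μ]) := by
    conv_lhs => enter [1]; unfold aggNoise aggLevel
    rw [covariance_fun_sum_left' (fun j _ => ((M.memLp_bridge j s).const_mul _).const_mul _)
      (M.memLp_aggNoise k s)]
    simp_rw [covariance_const_mul_left]
  rw [h1]
  have h2 : ∀ i ∈ Finset.univ.filter (fun i => k i = true), effVol σ k ^ 2 / σ i ^ 2 * (σ i *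
      cov[β i s, fun ω => aggNoise σ k (fun j => β j s ω); μ]) =
      effVol σ k ^ 2 * (s * (1 - s)) * (effVol σ k ^ 2 * (σ i ^ 2)⁻¹) := by
    intro i hi
    have hσ := (M.vol_pos i).ne'
    rw [M.covariance_bridge_aggNoise (by simpa using hi) le_rfl]
    field_simp
  rw [Finset.sum_congr rfl h2, ← Finset.mul_sum, ← Finset.mul_sum,
    effVol_sq_mul_sum M.vol_pos hk, mul_one]

lemma isGaussianProcess_bridges : IsGaussianProcess (fun q : Fin n × unitInterval => β q.1 q.2) μ :=
  isGaussianProcess_uncurry (fun i => (M.bridge i).gaussian) M.bridge_indep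

omit M in
lemma aggNoise_mem_span (k : Fin n → Bool) (s : unitInterval) :
    (fun ω => aggNoise σ k fun i => β i s ω) ∈
      Submodule.span ℝ (range fun q : Fin n × unitInterval => β q.1 q.2) := by
  have : (fun ω => aggNoise σ k fun i => β i s ω) =
      ∑ i with k i = true, (effVol σ k ^ 2 / σ i ^ 2 * σ i) • β i s := by
    ext ω; simp [aggNoise, aggLevel, mul_assoc]
  rw [this]
  exact Submodule.sum_mem _ fun i _ => Submodule.smul_mem _ _ (Submodule.subset_span ⟨(i, s), rfl⟩)

lemma map_aggNoise {k : Fin n → Bool} (hk : ∃ i, k i = true) (s : unitInterval) :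
    μ.map (fun ω => aggNoise σ k fun i => β i s ω) =
      gaussianReal 0 (noiseVar (effVol σ k) s) := by
  have hG : IsGaussianProcess (fun (_ : Unit) ω => aggNoise σ k fun i => β i s ω) μ :=
    IsGaussianProcess.of_mem_span M.isGaussianProcess_bridges fun _ => aggNoise_mem_span k s
  have hL := hG.hasGaussianLaw_eval ()
  rw [hL.map_eq_gaussianReal, ← covariance_self hL.aemeasurable, M.variance_aggNoise hk, noiseVar]
  congr 1
  unfold aggNoise aggLevel
  rw [integral_finsetSum _ fun i _ =>
    (((M.memLp_bridge i s).integrable (by norm_num)).const_mul _).const_mul _]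
  simp_rw [integral_const_mul, (M.bridge _).mean]
  simp

/-- The noise of the active sources up to time `s`, with its projection on the aggregate noise at
time `s` removed, is independent of the aggregate noise at time `s`. -/
lemma indepFun_residual_aggNoise {k : Fin n → Bool} (hk : ∃ i, k i = true) {s : unitInterval}
    (hs : 0 < s) :
    IndepFun (fun ω (q : {q : Fin n × unitInterval // k q.1 = true ∧ q.2 ≤ s}) =>
        σ q.1.1 * β q.1.1 q.1.2 ω - q.1.2 / s * aggNoise σ k (fun i => β i s ω))
      (fun ω => aggNoise σ k (fun i => β i s ω)) μ := by
  have hs0 : (s : ℝ) ≠ 0 := unitInterval.coe_ne_zero.2 hs.ne'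
  set R : {q : Fin n × unitInterval // k q.1 = true ∧ q.2 ≤ s} → Ω → ℝ := fun q ω =>
    σ q.1.1 * β q.1.1 q.1.2 ω - q.1.2 / s * aggNoise σ k (fun i => β i s ω) with hR
  set N : Unit → Ω → ℝ := fun _ ω => aggNoise σ k (fun i => β i s ω) with hN
  have hNm : Measurable fun ω => aggNoise σ k (fun i => β i s ω) :=
    (measurable_aggNoise σ k).comp (measurable_pi_lambda _ fun i => M.measurable_bridge i s)
  have hG : IsGaussianProcess (Sum.elim R N) μ := by
    refine IsGaussianProcess.of_mem_span M.isGaussianProcess_bridges fun q => ?_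
    rcases q with q | q
    · exact Submodule.sub_mem _
        (Submodule.smul_mem _ (σ q.1.1) (Submodule.subset_span ⟨q.1, rfl⟩))
        (Submodule.smul_mem _ ((q.1.2 : ℝ) / s) (aggNoise_mem_span k s))
    · exact aggNoise_mem_span k s
  have h := hG.indepFun_of_covariance_eq_zero
    (fun q => ((M.measurable_bridge q.1.1 q.1.2).const_mul _).sub (hNm.const_mul _)
      |>.aemeasurable) (fun _ => hNm.aemeasurable) fun q _ => by
      rw [hR, hN]
      have hσ := (M.vol_pos q.1.1).ne'
      simp only
      rw [covariance_fun_sub_left ((M.memLp_bridge _ _).const_mul _)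
        ((M.memLp_aggNoise k s).const_mul _) (M.memLp_aggNoise k s), covariance_const_mul_left,
        covariance_const_mul_left, M.covariance_bridge_aggNoise q.2.1 q.2.2,
        M.variance_aggNoise hk]
      field_simp
      ring
  exact h.comp measurable_id (measurable_pi_apply ())

lemma indepFun_signal_aggNoise (k : Fin n → Bool) (s : unitInterval) :
    IndepFun X (fun ω => aggNoise σ k fun i => β i s ω) μ :=
  M.signal_indep.comp (φ := id)
    (ψ := fun f : Fin n → unitInterval → ℝ => aggNoise σ k fun i => f i s) measurable_id
    (by fun_prop)

lemma bridge_one_ae_eq_zero (i : Fin n) : β i 1 =ᵐ[μ] 0 := by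
  have h := (M.bridge i).covariance 1 1
  have hm := (M.bridge i).mean 1
  rw [covariance_self (M.measurable_bridge i 1).aemeasurable,
    variance_of_integral_eq_zero (M.measurable_bridge i 1).aemeasurable hm] at h
  have h0 : ∫ ω, β i 1 ω ^ 2 ∂μ = 0 := by simpa using h
  rw [integral_eq_zero_iff_of_nonneg (fun ω => sq_nonneg _) (M.memLp_bridge i 1).integrable_sq]
    at h0
  filter_upwards [h0] with ω hω
  simpa using hω

/-- The path of the states together with the residual information of the active sources. -/
noncomputable def sideInfo (_ : IsInfoModel μ X σ β J) (k : Fin n → Bool) (s : unitInterval)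
    (ω : Ω) :
    (unitInterval → Fin n → Bool) ×
      ({q : Fin n × unitInterval // k q.1 = true ∧ q.2 ≤ s} → ℝ) :=
  (fun t => J t ω, fun q => infoProcess X σ β q.1.1 q.1.2 ω -
    q.1.2 / s * aggLevel σ k (fun i => infoProcess X σ β i s ω))

lemma measurable_aggLevel_info (k : Fin n → Bool) (s : unitInterval) :
    Measurable fun ω => aggLevel σ k fun i => infoProcess X σ β i s ω :=
  (measurable_aggLevel σ k).comp (measurable_pi_lambda _ fun i => M.measurable_info i s)

lemma measurable_sideInfo (k : Fin n → Bool) (s : unitInterval) : Measurable (M.sideInfo k s) :=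
  (measurable_pi_lambda _ M.measurable_state).prodMk (measurable_pi_lambda _ fun q =>
    (M.measurable_info q.1.1 q.1.2).sub ((M.measurable_aggLevel_info k s).const_mul _))

lemma indepFun_sideInfo {k : Fin n → Bool} (hk : ∃ i, k i = true) {s : unitInterval}
    (hs : 0 < s) :
    IndepFun (M.sideInfo k s)
      (fun ω => (X ω, aggLevel σ k fun i => infoProcess X σ β i s ω)) μ := by
  have hs0 : (s : ℝ) ≠ 0 := unitInterval.coe_ne_zero.2 hs.ne'
  have hNm : Measurable fun ω => aggNoise σ k (fun i => β i s ω) :=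
    (measurable_aggNoise σ k).comp (measurable_pi_lambda _ fun i => M.measurable_bridge i s)
  set R : Ω → {q : Fin n × unitInterval // k q.1 = true ∧ q.2 ≤ s} → ℝ := fun ω q =>
    σ q.1.1 * β q.1.1 q.1.2 ω - q.1.2 / s * aggNoise σ k (fun i => β i s ω) with hR
  have hRm : Measurable R := measurable_pi_lambda _ fun q =>
    ((M.measurable_bridge q.1.1 q.1.2).const_mul _).sub (hNm.const_mul _)
  have hRξ : R = fun ω q => infoProcess X σ β q.1.1 q.1.2 ω -
      q.1.2 / s * aggLevel σ k (fun i => infoProcess X σ β i s ω) := by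
    ext ω q
    rw [aggLevel_infoProcess M.vol_pos hk, hR, infoProcess]
    field_simp
    ring
  have h1 : IndepFun X (fun ω => (aggNoise σ k (fun i => β i s ω), R ω)) μ :=
    M.signal_indep.comp (φ := id) (ψ := fun f : Fin n → unitInterval → ℝ =>
      (aggNoise σ k fun i => f i s,
      fun q : {q : Fin n × unitInterval // k q.1 = true ∧ q.2 ≤ s} =>
        σ q.1.1 * f q.1.1 q.1.2 - q.1.2 / s * aggNoise σ k (fun i => f i s))) measurable_id
      (by fun_prop)
  have h2 := IndepFun.prodMk_left_of_prodMk_right M.measurable_signal hNm hRm h1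
    (M.indepFun_residual_aggNoise hk hs).symm
  have h3 : IndepFun R (fun ω => (X ω, aggLevel σ k fun i => infoProcess X σ β i s ω)) μ := by
    simp_rw [aggLevel_infoProcess M.vol_pos hk]
    exact (h2.comp (φ := fun q => (q.1, (s : ℝ) * q.1 + q.2)) (by fun_prop) measurable_id).symm
  obtain ⟨i₀, -⟩ := hk
  have hX : ∀ᵐ ω ∂μ, infoProcess X σ β i₀ 1 ω = X ω := by
    filter_upwards [M.bridge_one_ae_eq_zero i₀] with ω hω
    simp [infoProcess, hω]
  have h4 : IndepFun (fun ω t => J t ω)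
      (fun ω => (R ω, (X ω, aggLevel σ k fun i => infoProcess X σ β i s ω))) μ := by
    have h := M.state_indep.comp (φ := id) (ψ := fun f : Fin n → unitInterval → ℝ =>
      ((fun q : {q : Fin n × unitInterval // k q.1 = true ∧ q.2 ≤ s} => f q.1.1 q.1.2 -
        q.1.2 / s * aggLevel σ k (fun i => f i s)),
        (f i₀ 1, aggLevel σ k fun i => f i s))) measurable_id (by fun_prop)
    refine h.congr .rfl ?_
    filter_upwards [hX] with ω hω
    simp only [Function.comp, hω, hRξ]
  have h5 := IndepFun.prodMk_left_of_prodMk_right (measurable_pi_lambda _ M.measurable_state) hRm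
    (M.measurable_signal.prodMk (M.measurable_aggLevel_info k s)) h4 h3
  rw [hRξ] at h5
  exact h5

end IsInfoModel

lemma setIntegral_eq_sum_fiber {Ω κ : Type*} [MeasurableSpace Ω] {μ : Measure Ω} [Fintype κ]
    [MeasurableSpace κ] [MeasurableSingletonClass κ] {J : Ω → κ} (hJ : Measurable J) {f : Ω → ℝ}
    (hf : Integrable f μ) (A : Set Ω) :
    ∫ ω in A, f ω ∂μ = ∑ k, ∫ ω in A ∩ J ⁻¹' {k}, f ω ∂μ := by
  classical
  have hm : ∀ k, MeasurableSet (J ⁻¹' {k}) := fun k => hJ (measurableSet_singleton k)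
  have hsum : ∀ ω, f ω = ∑ k, (J ⁻¹' {k}).indicator f ω := fun ω => by
    rw [Finset.sum_eq_single (J ω)]
    · simp
    · intro k _ hk
      exact indicator_of_notMem (fun h => hk (by simpa using h.symm)) f
    · simp
  calc ∫ ω in A, f ω ∂μ = ∫ ω in A, ∑ k, (J ⁻¹' {k}).indicator f ω ∂μ := by simp_rw [← hsum]
    _ = ∑ k, ∫ ω in A, (J ⁻¹' {k}).indicator f ω ∂μ :=
        integral_finsetSum _ fun k _ => (hf.indicator (hm k)).integrableOn
    _ = _ := by simp_rw [setIntegral_indicator (hm _)]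

lemma comap_le_eventuallyMeasurableSpace {Ω E : Type*} {G : MeasurableSpace Ω}
    [mE : MeasurableSpace E] {l : Filter Ω} [CountableInterFilter l] {f g : Ω → E}
    (hg : Measurable[G] g) (hfg : f =ᶠ[l] g) :
    MeasurableSpace.comap f mE ≤ eventuallyMeasurableSpace G l :=
  measurable_iff_comap_le.1 (hg.eventuallyMeasurable_of_eventuallyEq hfg)

lemma measurable_posteriorMean_aggLevel {n : ℕ} (ν : Measure ℝ) [SFinite ν] (σ : Fin n → ℝ)
    (s : ℝ) :
    Measurable fun q : (Fin n → Bool) × (Fin n → ℝ) =>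
      posteriorMean ν (effVol σ q.1) s (aggLevel σ q.1 q.2) := by
  refine measurable_from_prod_countable_right fun k => ?_
  exact (measurable_posteriorMean ν (effVol σ k) s).comp (measurable_aggLevel σ k)

namespace IsInfoModel

set_option linter.unusedSectionVars false

variable {Ω : Type*} [m0 : MeasurableSpace Ω] {μ : Measure Ω} [IsProbabilityMeasure μ] {n : ℕ}
  {X : Ω → ℝ} {σ : Fin n → ℝ} {β : Fin n → unitInterval → Ω → ℝ}
  {J : unitInterval → Ω → Fin n → Bool} (M : IsInfoModel μ X σ β J)
include M

/-- The aggregate level of the sources that are active in the state `k`. -/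
noncomputable def level (_ : IsInfoModel μ X σ β J) (k : Fin n → Bool) (s : unitInterval)
    (ω : Ω) : ℝ :=
  aggLevel σ k fun i => infoProcess X σ β i s ω

/-- The conditional mean of the signal given the observations up to time `s`. -/
noncomputable def condMean (M : IsInfoModel μ X σ β J) (s : unitInterval) (ω : Ω) : ℝ :=
  posteriorMean (μ.map X) (effVol σ (J s ω)) s (M.level (J s ω) s ω)

/-- The observations up to time `s` that are available if the state at time `s` is `k`, and all
the states. -/
@[reducible]
noncomputable def stateSigma (M : IsInfoModel μ X σ β J) (k : Fin n → Bool) (s : unitInterval) :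
    MeasurableSpace Ω :=
  MeasurableSpace.comap (fun ω => (M.sideInfo k s ω, M.level k s ω)) inferInstance

lemma measurable_level (k : Fin n → Bool) (s : unitInterval) : Measurable (M.level k s) :=
  M.measurable_aggLevel_info k s

lemma measurable_level_noise (k : Fin n → Bool) (s : unitInterval) :
    Measurable fun ω => aggNoise σ k fun i => β i s ω :=
  (measurable_aggNoise σ k).comp (measurable_pi_lambda _ fun i => M.measurable_bridge i s)

lemma level_eq {k : Fin n → Bool} (hk : ∃ i, k i = true) (s : unitInterval) :
    M.level k s = fun ω => s * X ω + aggNoise σ k fun i => β i s ω :=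
  funext fun ω => aggLevel_infoProcess M.vol_pos hk X β s ω

lemma isProbabilityMeasure_law : IsProbabilityMeasure (μ.map X) :=
  Measure.isProbabilityMeasure_map M.measurable_signal.aemeasurable

lemma memLp_law : MemLp (fun x => x) 2 (μ.map X) :=
  (memLp_map_measure_iff aestronglyMeasurable_id M.measurable_signal.aemeasurable).2
    M.memLp_signal

lemma integrable_law : Integrable (fun x => x) (μ.map X) := by
  have := M.isProbabilityMeasure_law
  exact M.memLp_law.integrable (by norm_num)

lemma integrable_posteriorMean {s : unitInterval} (hs0 : 0 < s) (hs1 : s < 1)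
    (k : Fin n → Bool) :
    Integrable (fun ω => posteriorMean (μ.map X) (effVol σ k) s (M.level k s ω)) μ := by
  by_cases hk : ∃ i, k i = true
  · rw [M.level_eq hk]
    exact integrable_posteriorMean_level M.measurable_signal M.integrable_signal
      (M.measurable_level_noise k s) (M.indepFun_signal_aggNoise k s) (M.map_aggNoise hk s)
      (effVol_pos M.vol_pos hk) hs0 hs1
  · have : M.level k s = fun _ => 0 := by
      ext ω
      have hk' : (Finset.univ.filter fun i => k i = true) = ∅ := by
        simpa [Finset.filter_eq_empty_iff] using hk
      simp [level, aggLevel, hk']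
    rw [this]
    exact integrable_const _

lemma setIntegral_posteriorMean {s : unitInterval} (hs0 : 0 < s) (hs1 : s < 1)
    {k : Fin n → Bool} (hk : ∃ i, k i = true) {B : Set Ω} (hB : MeasurableSet[M.stateSigma k s] B) :
    ∫ ω in B, posteriorMean (μ.map X) (effVol σ k) s (M.level k s ω) ∂μ = ∫ ω in B, X ω ∂μ := by
  have := M.isProbabilityMeasure_law
  obtain ⟨D, hD, rfl⟩ := hB
  refine setIntegral_eq_of_indepFun_prodMk (M.measurable_sideInfo k s) M.measurable_signal
    (M.measurable_level k s) (M.indepFun_sideInfo hk hs0) (measurable_posteriorMean _ _ _)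
    M.integrable_signal (M.integrable_posteriorMean hs0 hs1 k) (fun C hC => ?_) hD
  rw [M.level_eq hk]
  exact setIntegral_posteriorMean_level M.measurable_signal M.integrable_signal
    (M.measurable_level_noise k s) (M.indepFun_signal_aggNoise k s) (M.map_aggNoise hk s)
    (effVol_pos M.vol_pos hk) hs0 hs1 hC

lemma measurable_sideInfo_level (k : Fin n → Bool) (s : unitInterval) :
    Measurable[M.stateSigma k s] fun ω => (M.sideInfo k s ω, M.level k s ω) :=
  comap_measurable _

lemma measurable_state_stateSigma (k : Fin n → Bool) (s u : unitInterval) :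
    Measurable[M.stateSigma k s] (J u) := by
  have h : Measurable fun q : ((unitInterval → Fin n → Bool) ×
      ({q : Fin n × unitInterval // k q.1 = true ∧ q.2 ≤ s} → ℝ)) × ℝ => q.1.1 u := by fun_prop
  exact h.comp (M.measurable_sideInfo_level k s)

/-- On the event that the state at time `s` is `k`, the observations up to time `s` are determined
by the residual information and the aggregate level. -/
lemma observedSigma_le {k : Fin n → Bool} {s : unitInterval} (hs0 : 0 < s) (hs1 : s < 1) :
    observedSigma X (infoProcess X σ β) J s ≤
      eventuallyMeasurableSpace (M.stateSigma k s) (ae (μ.restrict (J s ⁻¹' {k}))) := by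
  have hs : (s : ℝ) ≠ 0 := unitInterval.coe_ne_zero.2 hs0.ne'
  refine sup_le (sup_le (iSup_le fun u => ?_) (iSup_le fun u => ?_)) ?_
  · have hu : u.1 ≤ s := u.2
    set Φ : ((unitInterval → Fin n → Bool) ×
        ({q : Fin n × unitInterval // k q.1 = true ∧ q.2 ≤ s} → ℝ)) × ℝ → Fin n → ℝ :=
      fun q i => if q.1.1 u i = true then
        (if h : k i = true then q.1.2 ⟨(i, u), h, hu⟩ + (u : unitInterval) / s * q.2 else 0) else 0
      with hΦ
    have hΦm : Measurable Φ := by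
      refine measurable_pi_lambda _ fun i => Measurable.ite ?_ ?_ measurable_const
      · exact (by fun_prop : Measurable fun q : ((unitInterval → Fin n → Bool) ×
          ({q : Fin n × unitInterval // k q.1 = true ∧ q.2 ≤ s} → ℝ)) × ℝ => q.1.1 u i)
          (measurableSet_singleton true)
      · by_cases h : k i = true
        · simp only [h, dite_true]; fun_prop
        · simp only [h, dite_false, Bool.false_eq_true]; fun_prop
    refine comap_le_eventuallyMeasurableSpace
      (hΦm.comp (M.measurable_sideInfo_level k s)) ?_
    rw [EventuallyEq, ae_restrict_iff' (M.measurable_state s (measurableSet_singleton k))]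
    filter_upwards [M.mono] with ω hω hJk
    have hJk' : J s ω = k := hJk
    ext i
    simp only [modulated, hΦ, Function.comp, sideInfo, level]
    split_ifs with h1 h2
    · ring
    · exact absurd (hJk' ▸ hω i u s hu h1) h2
    · rfl
  · exact comap_le_eventuallyMeasurableSpace (M.measurable_state_stateSigma k s u) .rfl
  · simp [hs1.ne, MeasurableSpace.comap_const]

lemma ae_exists_active (s : unitInterval) : ∀ᵐ ω ∂μ, ∃ i, J s ω i = true := by
  filter_upwards [M.mono, M.start] with ω h1 ⟨i, hi⟩
  exact ⟨i, h1 i 0 s unitInterval.nonneg' hi⟩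

lemma measure_inactive {k : Fin n → Bool} (hk : ¬∃ i, k i = true) (s : unitInterval) :
    μ (J s ⁻¹' {k}) = 0 := by
  refine measure_mono_null (fun ω (hω : J s ω = k) => ?_) (ae_iff.1 (M.ae_exists_active s))
  simpa [hω] using hk

lemma condMean_eq_sum (s : unitInterval) (ω : Ω) :
    M.condMean s ω = ∑ k, (J s ⁻¹' {k}).indicator
      (fun ω => posteriorMean (μ.map X) (effVol σ k) s (M.level k s ω)) ω := by
  rw [Finset.sum_eq_single (J s ω)]
  · simp [condMean]
  · intro k _ hk
    exact indicator_of_notMem (fun h => hk (by simpa using h.symm)) _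
  · simp

lemma integrable_condMean {s : unitInterval} (hs0 : 0 < s) (hs1 : s < 1) :
    Integrable (M.condMean s) μ := by
  have : M.condMean s = fun ω => ∑ k, (J s ⁻¹' {k}).indicator
      (fun ω => posteriorMean (μ.map X) (effVol σ k) s (M.level k s ω)) ω :=
    funext (M.condMean_eq_sum s)
  rw [this]
  exact integrable_finsetSum _ fun k _ => (M.integrable_posteriorMean hs0 hs1 k).indicator
    (M.measurable_state s (measurableSet_singleton k))

lemma condMean_eq_comp (s : unitInterval) :
    M.condMean s = (fun q : (Fin n → Bool) × (Fin n → ℝ) =>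
      posteriorMean (μ.map X) (effVol σ q.1) s (aggLevel σ q.1 q.2)) ∘
        fun ω => (J s ω, modulated (infoProcess X σ β) J s ω) := by
  ext ω
  rw [condMean, level]
  simp only [Function.comp]
  congr 1
  exact aggLevel_congr fun i hi => by simp [modulated, hi]

lemma measurable_condMean_observed (s : unitInterval) :
    Measurable[observedSigma X (infoProcess X σ β) J s] (M.condMean s) := by
  have := M.isProbabilityMeasure_law
  rw [M.condMean_eq_comp]
  have h1 : MeasurableSpace.comap (J s) inferInstance ≤ observedSigma X (infoProcess X σ β) J s :=
    le_sup_of_le_left (le_sup_of_le_right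
      (le_iSup_of_le (ι := Iic s) ⟨s, mem_Iic.2 le_rfl⟩ le_rfl))
  have h2 : MeasurableSpace.comap (modulated (infoProcess X σ β) J s) inferInstance ≤
      observedSigma X (infoProcess X σ β) J s :=
    le_sup_of_le_left (le_sup_of_le_left
      (le_iSup_of_le (ι := Iic s) ⟨s, mem_Iic.2 le_rfl⟩ le_rfl))
  exact (measurable_posteriorMean_aggLevel (μ.map X) σ s).comp
    ((measurable_iff_comap_le.2 h1).prodMk (measurable_iff_comap_le.2 h2))

lemma setIntegral_condMean {s : unitInterval} (hs0 : 0 < s) (hs1 : s < 1) {A : Set Ω}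
    (hA : MeasurableSet[completedFiltration μ X (infoProcess X σ β) J s] A) :
    ∫ ω in A, M.condMean s ω ∂μ = ∫ ω in A, X ω ∂μ := by
  have hJm : ∀ k, MeasurableSet (J s ⁻¹' {k}) := fun k =>
    M.measurable_state s (measurableSet_singleton k)
  obtain ⟨hA0, A', hA', hAA'⟩ := hA
  rw [setIntegral_eq_sum_fiber (M.measurable_state s) (M.integrable_condMean hs0 hs1),
    setIntegral_eq_sum_fiber (M.measurable_state s) M.integrable_signal]
  refine Finset.sum_congr rfl fun k _ => ?_
  by_cases hk : ∃ i, k i = true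
  · obtain ⟨B, hB, hAB⟩ := M.observedSigma_le (k := k) hs0 hs1 A' hA'
    have hAB' : (A ∩ J s ⁻¹' {k} : Set Ω) =ᵐ[μ] (B ∩ J s ⁻¹' {k} : Set Ω) := by
      have hAB := (ae_restrict_iff' (hJm k)).1 hAB
      filter_upwards [hAA', hAB] with ω h1 h2
      by_cases hω : ω ∈ J s ⁻¹' {k}
      · have h3 := h1.trans (h2 hω)
        simp only [eq_iff_iff] at h3 ⊢
        exact and_congr_left fun _ => h3
      · simp only [eq_iff_iff]
        exact ⟨fun h => absurd h.2 hω, fun h => absurd h.2 hω⟩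
    rw [setIntegral_congr_set hAB', setIntegral_congr_set hAB',
      ← M.setIntegral_posteriorMean hs0 hs1 hk
        (hB.inter (M.measurable_state_stateSigma k s s (measurableSet_singleton k)))]
    have hle : M.stateSigma k s ≤ m0 :=
      ((M.measurable_sideInfo k s).prodMk (M.measurable_level k s)).comap_le
    refine setIntegral_congr_fun ((hle _ hB).inter (hJm k)) fun ω hω => ?_
    have : J s ω = k := hω.2
    simp only [condMean, this]
  · have h0 : μ (A ∩ J s ⁻¹' {k}) = 0 :=
      measure_mono_null inter_subset_right (M.measure_inactive hk s)
    rw [setIntegral_measure_zero _ h0, setIntegral_measure_zero _ h0]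

lemma measurable_condMean_completed (s : unitInterval) :
    Measurable[completedFiltration μ X (infoProcess X σ β) J s] (M.condMean s) := by
  have hle : observedSigma X (infoProcess X σ β) J s ≤ m0 := by
    refine sup_le (sup_le (iSup_le fun u => ?_) (iSup_le fun u => ?_)) ?_
    · refine Measurable.comap_le (measurable_pi_lambda _ fun i => ?_)
      refine Measurable.ite ?_ (M.measurable_info i u) measurable_const
      exact (measurable_pi_apply i).comp (M.measurable_state u) (measurableSet_singleton true)
    · exact (M.measurable_state u).comap_le
    · refine Measurable.comap_le ?_
      split_ifs
      · exact M.measurable_signal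
      · exact measurable_const
  exact (M.measurable_condMean_observed s).mono
    (le_inf hle le_eventuallyMeasurableSpace) le_rfl

lemma condMean_ae_eq_condExp_completed {s : unitInterval} (hs0 : 0 < s) (hs1 : s < 1) :
    M.condMean s =ᵐ[μ] μ[X | completedFiltration μ X (infoProcess X σ β) J s] :=
  ae_eq_condExp_of_forall_setIntegral_eq (Filtration.le _ s) M.integrable_signal
    (fun _ _ _ => (M.integrable_condMean hs0 hs1).integrableOn)
    (fun _ hA _ => M.setIntegral_condMean hs0 hs1 hA)
    (M.measurable_condMean_completed s).stronglyMeasurable.aestronglyMeasurable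

lemma integral_sq_bridge_sub (i : Fin n) (s t : unitInterval) :
    ∫ ω, (β i s ω - β i t ω) ^ 2 ∂μ =
      s - s * s - 2 * (min (s : ℝ) t - s * t) + (t - t * t) := by
  have h0 : ∫ ω, (β i s ω - β i t ω) ∂μ = 0 := by
    rw [integral_sub ((M.memLp_bridge i s).integrable (by norm_num))
      ((M.memLp_bridge i t).integrable (by norm_num)), (M.bridge i).mean, (M.bridge i).mean,
      sub_zero]
  rw [← variance_of_integral_eq_zero (X := fun ω => β i s ω - β i t ω)
    ((M.measurable_bridge i s).sub (M.measurable_bridge i t)).aemeasurable h0,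
    variance_fun_sub (M.memLp_bridge i s) (M.memLp_bridge i t),
    ← covariance_self (M.measurable_bridge i s).aemeasurable,
    ← covariance_self (M.measurable_bridge i t).aemeasurable, (M.bridge i).covariance,
    (M.bridge i).covariance, (M.bridge i).covariance, min_self, min_self]

lemma exists_seq_bridge_tendsto {t : unitInterval} (ht1 : t < 1) :
    ∃ u : ℕ → unitInterval, (∀ m, u m ∈ Ioo t 1) ∧ Tendsto u atTop (𝓝 t) ∧
      ∀ᵐ ω ∂μ, ∀ i, Tendsto (fun m => β i (u m) ω) atTop (𝓝 (β i t ω)) := by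
  obtain ⟨u, -, hu, hut⟩ := exists_seq_strictAnti_tendsto' ht1
  set D : ℕ → Ω → ℝ := fun m ω => ∑ i, (β i (u m) ω - β i t ω) ^ 2 with hD
  have hint : ∀ m i, Integrable (fun ω => (β i (u m) ω - β i t ω) ^ 2) μ := fun m i =>
    ((M.memLp_bridge i (u m)).sub (M.memLp_bridge i t)).integrable_sq
  have hDi : ∀ m, Integrable (D m) μ := fun m => integrable_finsetSum _ fun i _ => hint m i
  have hD0 : Tendsto (fun m => ∫ ω, D m ω ∂μ) atTop (𝓝 0) := by
    have hut' : Tendsto (fun m => ((u m : unitInterval) : ℝ)) atTop (𝓝 (t : ℝ)) :=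
      (continuous_subtype_val.tendsto t).comp hut
    have h : Tendsto (fun m => ∑ _i : Fin n, ((u m : ℝ) - u m * u m -
        2 * (min (u m : ℝ) t - u m * t) + ((t : ℝ) - t * t))) atTop
        (𝓝 (∑ _i : Fin n, ((t : ℝ) - t * t - 2 * (min (t : ℝ) t - t * t) + ((t : ℝ) - t * t)))) :=
      tendsto_finsetSum _ fun i _ => ((hut'.sub (hut'.mul hut')).sub
        (((hut'.min tendsto_const_nhds).sub (hut'.mul_const _)).const_mul 2)).add_const _
    have h0 : ∑ _i : Fin n, ((t : ℝ) - t * t - 2 * (min (t : ℝ) t - t * t) + ((t : ℝ) - t * t)) =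
        0 := Finset.sum_eq_zero fun i _ => by rw [min_self]; ring
    rw [h0] at h
    refine h.congr fun m => ?_
    rw [hD, integral_finsetSum _ fun i _ => hint m i]
    simp_rw [M.integral_sq_bridge_sub]
  have hmeas : TendstoInMeasure μ D atTop 0 := by
    refine tendstoInMeasure_of_tendsto_eLpNorm one_ne_zero (fun m => (hDi m).aestronglyMeasurable)
      aestronglyMeasurable_zero ?_
    have : ∀ m, eLpNorm (D m - 0) 1 μ = ENNReal.ofReal (∫ ω, D m ω ∂μ) := fun m => by
      rw [sub_zero, eLpNorm_one_eq_lintegral_enorm,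
        ← ofReal_integral_norm_eq_lintegral_enorm (hDi m)]
      congr 2 with ω
      exact Real.norm_of_nonneg (Finset.sum_nonneg fun i _ => sq_nonneg _)
    simp_rw [this]
    simpa using ENNReal.tendsto_ofReal hD0
  obtain ⟨ns, hns, hae⟩ := hmeas.exists_seq_tendsto_ae
  refine ⟨u ∘ ns, fun m => hu _, hut.comp hns.tendsto_atTop, ?_⟩
  filter_upwards [hae] with ω hω i
  have h1 : Tendsto (fun m => (β i (u (ns m)) ω - β i t ω) ^ 2) atTop (𝓝 0) :=
    squeeze_zero (fun m => sq_nonneg _) (fun m => Finset.single_le_sum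
      (f := fun i => (β i (u (ns m)) ω - β i t ω) ^ 2) (fun j _ => sq_nonneg _)
      (Finset.mem_univ i)) hω
  have h2 : Tendsto (fun m => |β i (u (ns m)) ω - β i t ω|) atTop (𝓝 0) := by
    simpa [Real.sqrt_sq_eq_abs] using h1.sqrt
  exact tendsto_iff_norm_sub_tendsto_zero.2 h2

lemma exists_seq_condMean_tendsto {t : unitInterval} (ht0 : 0 < t) (ht1 : t < 1) :
    ∃ u : ℕ → unitInterval, (∀ m, u m ∈ Ioo t 1) ∧
      ∀ᵐ ω ∂μ, Tendsto (fun m => M.condMean (u m) ω) atTop (𝓝 (M.condMean t ω)) := by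
  have := M.isProbabilityMeasure_law
  obtain ⟨u, hu, hut, hβ⟩ := M.exists_seq_bridge_tendsto ht1
  refine ⟨u, hu, ?_⟩
  have hut' : Tendsto (fun m => ((u m : unitInterval) : ℝ)) atTop (𝓝 (t : ℝ)) :=
    (continuous_subtype_val.tendsto t).comp hut
  filter_upwards [hβ, M.ae_exists_active t] with ω hω hk
  have hJt : Tendsto (fun m => J (u m) ω) atTop (𝓝 (J t ω)) :=
    (M.cadlag ω t).1.tendsto.comp (tendsto_nhdsWithin_iff.2
      ⟨hut, .of_forall fun m => (hu m).1.le⟩)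
  rw [nhds_discrete, tendsto_pure] at hJt
  have hlev : Tendsto (fun m => M.level (J t ω) (u m) ω) atTop (𝓝 (M.level (J t ω) t ω)) := by
    refine ((continuous_aggLevel σ (J t ω)).tendsto _).comp (tendsto_pi_nhds.2 fun i => ?_)
    exact (hut'.mul_const _).add ((hω i).const_mul _)
  refine (tendsto_posteriorMean M.integrable_law (effVol_pos M.vol_pos hk) ht0 ht1 hut'
    hlev).congr' ?_
  filter_upwards [hJt] with m hm
  rw [condMean, hm]

lemma condMean_ae_eq_condExp_market {t : unitInterval} (ht0 : 0 < t) (ht1 : t < 1) :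
    M.condMean t =ᵐ[μ] μ[X | marketFiltration μ X (infoProcess X σ β) J t] := by
  obtain ⟨u, hu, hconv⟩ := M.exists_seq_condMean_tendsto ht0 ht1
  have hu0 : ∀ m, 0 < u m := fun m => ht0.trans (hu m).1
  have hae : ∀ᵐ ω ∂μ, ∀ m, M.condMean (u m) ω =
      (μ[X | completedFiltration μ X (infoProcess X σ β) J (u m)]) ω :=
    ae_all_iff.2 fun m => M.condMean_ae_eq_condExp_completed (hu0 m) (hu m).2
  have hui := M.integrable_signal.uniformIntegrable_condExp
    (ℱ := fun m => completedFiltration μ X (infoProcess X σ β) J (u m))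
    fun m => Filtration.le _ _
  have hL1 := tendsto_Lp_finite_of_tendsto_ae le_rfl ENNReal.one_ne_top
    (fun m => integrable_condExp.aestronglyMeasurable)
    (memLp_one_iff_integrable.2 (M.integrable_condMean ht0 ht1)) hui.2.1 (by
      filter_upwards [hconv, hae] with ω h1 h2
      exact h1.congr h2)
  refine ae_eq_condExp_of_forall_setIntegral_eq (Filtration.le _ t) M.integrable_signal
    (fun _ _ _ => (M.integrable_condMean ht0 ht1).integrableOn) (fun A hA _ => ?_)
    (((M.measurable_condMean_completed t).mono (Filtration.le_rightCont _ t)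
      le_rfl).stronglyMeasurable.aestronglyMeasurable)
  have hlim := tendsto_setIntegral_of_L1' (M.condMean t)
    (M.integrable_condMean ht0 ht1).aestronglyMeasurable
    (.of_forall fun m => integrable_condExp) hL1 A
  refine tendsto_nhds_unique hlim (tendsto_const_nhds.congr fun m => ?_)
  have hAm : MeasurableSet[completedFiltration μ X (infoProcess X σ β) J (u m)] A := by
    have hmax : ¬IsMax t := not_isMax_iff.2 ⟨1, ht1⟩
    have hA' := hA
    rw [marketFiltration, Filtration.rightCont_eq_of_not_isMax _ hmax] at hA'
    have hle : ⨅ j > t, completedFiltration μ X (infoProcess X σ β) J j ≤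
        completedFiltration μ X (infoProcess X σ β) J (u m) := iInf₂_le (u m) (hu m).1
    exact hle A hA'
  rw [setIntegral_condExp (Filtration.le _ _) M.integrable_signal hAm]

lemma indepFun_state_level (k : Fin n → Bool) (t : unitInterval) :
    IndepFun (J t) (M.level k t) μ :=
  M.state_indep.comp (φ := fun j : unitInterval → Fin n → Bool => j t)
    (ψ := fun f : Fin n → unitInterval → ℝ => aggLevel σ k fun i => f i t) (by fun_prop)
    (by fun_prop)

lemma setIntegral_state_comp_level (k : Fin n → Bool) (t : unitInterval) {f : ℝ → ℝ}
    (hf : Measurable f) :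
    ∫ ω in J t ⁻¹' {k}, f (M.level k t ω) ∂μ =
      μ.real (J t ⁻¹' {k}) * ∫ ω, f (M.level k t ω) ∂μ := by
  have hm : MeasurableSet (J t ⁻¹' {k}) := M.measurable_state t (measurableSet_singleton k)
  have h := (M.indepFun_state_level k t).integral_fun_comp_mul_comp
    (f := ({k} : Set (Fin n → Bool)).indicator fun _ => (1 : ℝ)) (g := f)
    (M.measurable_state t).aemeasurable (M.measurable_level k t).aemeasurable
    (measurable_of_finite _).aestronglyMeasurable hf.aestronglyMeasurable
  have h1 : ∀ ω, ({k} : Set (Fin n → Bool)).indicator (fun _ => (1 : ℝ)) (J t ω) =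
      (J t ⁻¹' {k}).indicator (fun _ => (1 : ℝ)) ω := fun ω => rfl
  have h2 : ∀ ω, (J t ⁻¹' {k}).indicator (fun _ => (1 : ℝ)) ω * f (M.level k t ω) =
      (J t ⁻¹' {k}).indicator (fun ω => f (M.level k t ω)) ω := fun ω => by
    by_cases hω : ω ∈ J t ⁻¹' {k} <;> simp [hω]
  simp_rw [h1, h2] at h
  rw [integral_indicator hm, integral_indicator_const _ hm, smul_eq_mul, mul_one] at h
  exact h

lemma integral_call {t : unitInterval} (ht0 : 0 < t) (ht1 : t < 1) {p K : ℝ} (hp : 0 < p)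
    (hgt : μ {ω | K < p * X ω} ≠ 0) {ς : (Fin n → Bool) → ℝ}
    (hς : ∀ k, (∃ i, k i = true) →
      ∫ x, criticalIntegrand p K (effVol σ k) t (ς k) x ∂(μ.map X) = 0) :
    ∫ ω, max (p * M.condMean t ω - K) 0 ∂μ = ∑ k : Fin n → Bool, μ.real (J t ⁻¹' {k}) *
      (p * ∫ x, x * exerciseProb (effVol σ k) t (ς k) x ∂(μ.map X) -
        K * ∫ x, exerciseProb (effVol σ k) t (ς k) x ∂(μ.map X)) := by
  have := M.isProbabilityMeasure_law
  have hint : Integrable (fun ω => max (p * M.condMean t ω - K) 0) μ :=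
    (((M.integrable_condMean ht0 ht1).const_mul p).sub (integrable_const K)).pos_part
  rw [← setIntegral_univ, setIntegral_eq_sum_fiber (M.measurable_state t) hint]
  refine Finset.sum_congr rfl fun k _ => ?_
  rw [univ_inter]
  by_cases hk : ∃ i, k i = true
  · have h1 : ∫ ω in J t ⁻¹' {k}, max (p * M.condMean t ω - K) 0 ∂μ =
        ∫ ω in J t ⁻¹' {k},
          max (p * posteriorMean (μ.map X) (effVol σ k) t (M.level k t ω) - K) 0 ∂μ := by
      refine setIntegral_congr_fun (M.measurable_state t (measurableSet_singleton k))
        fun ω hω => ?_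
      have : J t ω = k := hω
      simp only [condMean, this]
    have hm := measurable_posteriorMean (μ.map X) (effVol σ k) t
    rw [h1, M.setIntegral_state_comp_level k t
      (f := fun y => max (p * posteriorMean (μ.map X) (effVol σ k) t y - K) 0) (by fun_prop),
      M.level_eq hk, integral_call_level M.measurable_signal M.integrable_signal
        (M.measurable_level_noise k t) (M.indepFun_signal_aggNoise k t) (M.map_aggNoise hk t)
        (effVol_pos M.vol_pos hk) ht0 ht1 hp hgt (hς k hk)]
  · have h0 := M.measure_inactive hk t
    rw [setIntegral_measure_zero _ h0, measureReal_def, h0, ENNReal.toReal_zero, zero_mul]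

end IsInfoModel

end ModulatedInfo

theorem mainTheorem3 {Ω : Type*} [m0 : MeasurableSpace Ω] (μ : Measure Ω) [IsProbabilityMeasure μ]
    (n : ℕ) (X : Ω → ℝ) (hX : Measurable X) (hX2 : MemLp X 2 μ)
    (σ : Fin n → ℝ) (hσ : ∀ i, 0 < σ i)
    (β : Fin n → unitInterval → Ω → ℝ) (hβ : ∀ i, IsBrownianBridge (β i) μ)
    -- `X` and the bridges are mutually independent
    (hβ_indep : iIndepFun (fun i ω t => β i t ω) μ)
    (hXβ_indep : IndepFun X (fun ω i t => β i t ω) μ)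
    (J : unitInterval → Ω → Fin n → Bool) (hJ : ∀ t, Measurable (J t))
    (hJ_cadlag : ∀ ω, IsCadlag (fun t => J t ω))
    (hJ_indep : IndepFun (fun ω t => J t ω)
      (fun ω i t => infoProcess X σ β i t ω) μ)
    -- sources never switch off, and some source is active at time `0`
    (hJ_mono : ∀ᵐ ω ∂μ, ∀ i, ∀ s u : unitInterval, s ≤ u → J s ω i = true → J u ω i = true)
    (hJ_zero : ∀ᵐ ω ∂μ, ∃ i, J 0 ω i = true)
    (P : ℝ → ℝ) (hP : IsDiscountFunction P)
    (K : ℝ) (t : unitInterval) (ht0 : 0 < t) (ht1 : t < 1)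
    -- the discounted cash flow lies on either side of the strike with positive probability
    (hK_lt : 0 < μ {ω | discountToOne P t * X ω < K})
    (hK_gt : 0 < μ {ω | K < discountToOne P t * X ω}) :
    Integrable (fun ω =>
      max (assetPrice μ (marketFiltration μ X (infoProcess X σ β) J) P X t ω - K) 0) μ ∧
    (∀ k : Fin n → Bool, (∃ i, k i = true) →
      (∀ z, Integrable (criticalIntegrand (discountToOne P t) K (effVol σ k) t z) (μ.map X)) ∧
      ∃! z, ∫ x, criticalIntegrand (discountToOne P t) K (effVol σ k) t z x ∂(μ.map X) = 0) ∧
    ∀ ς : (Fin n → Bool) → ℝ,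
      (∀ k, (∃ i, k i = true) →
        ∫ x, criticalIntegrand (discountToOne P t) K (effVol σ k) t (ς k) x ∂(μ.map X) = 0) →
      (∀ k, Integrable
        (fun x => x * exerciseProb (effVol σ k) t (ς k) x) (μ.map X)) ∧
      (∀ k, Integrable (exerciseProb (effVol σ k) t (ς k)) (μ.map X)) ∧
      μ.real {ω | J t ω = fun _ => false} = 0 ∧
      callPrice μ P
          (assetPrice μ (marketFiltration μ X (infoProcess X σ β) J) P X t) K t =
        P t * ∑ k : Fin n → Bool, μ.real {ω | J t ω = k} *
            (discountToOne P t * ∫ x, x * exerciseProb (effVol σ k) t (ς k) x ∂(μ.map X)) -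
          P t * ∑ k : Fin n → Bool, μ.real {ω | J t ω = k} *
            (K * ∫ x, exerciseProb (effVol σ k) t (ς k) x ∂(μ.map X)) := by
  have M : IsInfoModel μ X σ β J := ⟨hX, hX2, hσ, hβ, hβ_indep, hXβ_indep, hJ, hJ_cadlag, hJ_indep,
    hJ_mono, hJ_zero⟩
  have := M.isProbabilityMeasure_law
  have ht0' : (0 : ℝ) < t := ht0
  have ht1' : (t : ℝ) < 1 := ht1
  have hp : 0 < discountToOne P t := div_pos (hP.pos 1 zero_le_one) (hP.pos t ht0'.le)
  have hlt : μ.map X {x | discountToOne P t * x < K} ≠ 0 := by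
    rw [Measure.map_apply hX (measurableSet_lt (by fun_prop) (by fun_prop))]
    exact hK_lt.ne'
  have hgt : μ.map X {x | K < discountToOne P t * x} ≠ 0 := by
    rw [Measure.map_apply hX (measurableSet_lt (by fun_prop) (by fun_prop))]
    exact hK_gt.ne'
  refine ⟨?_, fun k hk => ⟨fun z => ?_, ?_⟩, fun ς hς => ⟨fun k => ?_, fun k => ?_, ?_, ?_⟩⟩
  · exact ((integrable_condExp.const_mul (discountToOne P t)).sub (integrable_const K)).pos_part
  · exact integrable_criticalIntegrand M.integrable_law _ _ (effVol_pos hσ hk) ht0' ht1' z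
  · exact existsUnique_criticalLevel M.memLp_law hp (effVol_pos hσ hk) ht0' ht1' hlt hgt
  · exact integrable_mul_exerciseProb M.integrable_law _ _ _
  · exact integrable_exerciseProb _ _ _
  · rw [measureReal_def, show μ {ω | J t ω = fun _ => false} = 0 from
      M.measure_inactive (by simp) t, ENNReal.toReal_zero]
  · have hprice : ∫ ω, max (assetPrice μ (marketFiltration μ X (infoProcess X σ β) J) P X t ω - K) 0
        ∂μ = ∫ ω, max (discountToOne P t * M.condMean t ω - K) 0 ∂μ := by
      refine integral_congr_ae ?_
      filter_upwards [M.condMean_ae_eq_condExp_market ht0 ht1] with ω hω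
      rw [assetPrice, hω]
    rw [callPrice, hprice, M.integral_call ht0 ht1 hp hK_gt.ne' hς, ← mul_sub,
      ← Finset.sum_sub_distrib]
    simp_rw [mul_sub]
    rfl
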